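/- **Setting.** All manifolds are smooth and finite dimensional, without boundary. Let $\phi:E\to M$ be a smooth fiber bundle with fiber $F$; put $C'(E):=E\times M$ and let $C''(E)$ be the set of pairs $((\epsilon_0,m_1),(\epsilon_1,m_2))$ in $C'(E)$ with $m_1=\phi(\epsilon_1)$. A *discrete path* in $C'(E)$ is a tuple $x=(x_0,\dots,x_{N-1})$, $x_k=(\epsilon_k,m_{k+1})\in C'(E)$, with $m_k=\phi(\epsilon_k)$ for $1\le k\le N-1$. A *discrete Lagrange–D'Alembert–Poincaré system* (DLDPS) over $E$ is $\mathcal M=(E,L_d,\mathcal D_d,\mathcal D,\mathcal P)$, where $L_d:C'(E)\to\mathbb R$ is smooth, $\mathcal D_d\subset C'(E)$ is a regular submanifold, $\mathcal D$ is a smooth subbundle of $p_1^*(TE)\subset T(C'(E))$ (its vectors have the form $(\delta\epsilon,0)$), and $\mathcal P$ is a smooth vector bundle map which to $(x,y)\in C''(E)$, $x=(\epsilon_0,m_1)$, and $(\delta\epsilon_1,0)\in\mathcal D_y$ assigns $\mathcal P(x,y)(\delta\epsilon_1,0)\in\ker d\phi(\epsilon_0)\subset T_{\epsilon_0}E$.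 A *nonholonomic infinitesimal variation with fixed endpoints* over a discrete path $x$ is a tangent vector $((\delta\epsilon_0,\delta m_1),\dots,(\delta\epsilon_{N-1},\delta m_N))$ of $C'(E)^N$ at $x$ with $\delta m_k=d\phi(\epsilon_k)(\delta\epsilon_k)$ for $1\le k\le N-1$, $\delta m_N=0$, and, for some $(t_k,0)\in\mathcal D_{x_k}$ ($1\le k\le N-1$), $\delta\epsilon_k=t_k+\mathcal P(x_k,x_{k+1})(t_{k+1},0)$ for $0\le k\le N-1$, where the first summand is omitted for $k=0$ and the second for $k=N-1$. The path $x$ is a *trajectory* of $\mathcal M$ if $x_k\in\mathcal D_d$ for all $k$ and the differential at $x$ of $S_d(x):=\sum_{k=0}^{N-1}L_d(x_k)$ vanishes on all these variations. It *satisfies the equations of motion* of $\mathcal M$ if $x_k\in\mathcal D_d$ for all $k$ and $\nu_d(x_{k-1},x_k)=0$ on $\mathcal D_{x_k}$ for $1\le k\le N-1$, where for $(x,y)\in C''(E)$, $y=(\epsilon_1,m_2)$, $$\nu_d(x,y)(\delta\epsilon_1,0)=D_1L_d(y)(\delta\epsilon_1)+D_2L_d(x)(d\phi(\epsilon_1)\delta\epsilon_1)+D_1L_d(x)\big(\mathcal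 P(x,y)(\delta\epsilon_1,0)\big).$$ A Lie group $G$ *acts on the fiber bundle* $(E,M,\phi,F)$ if it acts smoothly and freely on the left on $E$ and $M$ and smoothly on the right on $F$, $\pi:M\to M/G$ is a principal $G$-bundle, $\phi$ is equivariant, and $M$ is covered by $G$-invariant open sets $U$ with trivializations $\phi^{-1}(U)\cong U\times F$ which are equivariant for $g\cdot(m,f)=(gm,fg^{-1})$. It is a *symmetry group* of $\mathcal M$ if moreover $L_d$, $\mathcal D_d$ and $\mathcal D$ are invariant and $\mathcal P$ is equivariant under the induced actions. A *discrete connection* $\mathcal A_d$ on $\pi$ is a $G$-invariant submanifold $Hor\subset M\times M$ such that $(id\times\pi)|_{Hor}:Hor\to M\times(M/G)$ is an injective local diffeomorphism and $Hor\ni(q,\gamma(q)q)$ for all $q$, for a smooth map $\gamma:M\to G$ with $\gamma(gq)=g\gamma(q)g^{-1}$. On its domain $\mathfrak U=\{(q_0,gq_1):(q_0,q_1)\in Hor,\ g\in G\}$ one defines $\mathcal A_d(q_0,q_1)$ as the unique $g\in G$ with $(q_0,g^{-1}q_1)\in Hor$. The *conjugate bundle* $\widetilde G_E\to M/G$ is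 the quotient of $E\times G$ by $g\cdot(\epsilon,h)=(g\epsilon,ghg^{-1})$, with projection $[\epsilon,h]\mapsto\pi(\phi(\epsilon))$. Put $$\Upsilon(\epsilon,m):=\Upsilon_{\mathcal A_d}(\epsilon,m):=\big([\epsilon,\mathcal A_d(\phi(\epsilon),m)],\pi(m)\big)\in C'(\widetilde G_E)=\widetilde G_E\times(M/G)$$ for $(\phi(\epsilon),m)\in\mathfrak U$. The *reduced system* $\mathcal M/(G,\mathcal A_d)=(\widetilde G_E,\check L_d,\check{\mathcal D}_d,\check{\mathcal D},\check{\mathcal P})$ is defined by $\check L_d\circ\Upsilon=L_d$, $\check{\mathcal D}_d=\Upsilon(\mathcal D_d)$, $\check{\mathcal D}=d\Upsilon(\mathcal D)$ and $$\check{\mathcal P}(\Upsilon(x),\Upsilon(y))\big(d\Upsilon(y)(\delta\epsilon_1,0)\big)=d(p_1\circ\Upsilon)(x)\big(\mathcal P(x,y)(\delta\epsilon_1,0),\,d\phi(\epsilon_1)(\delta\epsilon_1)\big)$$ for $(x,y)\in C''(E)$, $y=(\epsilon_1,m_2)$, $(\delta\epsilon_1,0)\in\mathcal D_y$ (if $\mathfrak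 U\ne M\times M$, everything is restricted to the open sets where $\Upsilon$ is defined, and to their images). **Theorem.** Let $G$ be a symmetry group of the DLDPS $\mathcal M$, let $\mathcal A_d$ be a discrete connection on $\pi:M\to M/G$, let $x=(x_0,\dots,x_{N-1})$, $x_k=(\epsilon_k,m_{k+1})$, be a discrete path in $C'(E)$ with $(\phi(\epsilon_k),m_{k+1})\in\mathfrak U$ for all $k$ (no condition if $\mathcal A_d$ is globally defined), and let $y_k:=(v_k,r_{k+1}):=\Upsilon_{\mathcal A_d}(\epsilon_k,m_{k+1})$ for $0\le k\le N-1$. Then $y=(y_0,\dots,y_{N-1})$ is a discrete path in $C'(\widetilde G_E)$, and the following are equivalent: 1. $x$ is a trajectory of $\mathcal M$; 2. $x$ satisfies the equations of motion of $\mathcal M$; 3. $y$ is a trajectory of $\mathcal M/(G,\mathcal A_d)$; 4. $y$ satisfies the equations of motion of $\mathcal M/(G,\mathcal A_d)$. -/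

import Mathlib

open scoped Manifold ContDiff
open Set

noncomputable section

set_option linter.unusedSectionVars false

/-! All manifolds are smooth, finite dimensional and without boundary; a manifold `X` modelled on
the real vector space `V` carries `[ChartedSpace V X] [IsManifold 𝓘(ℝ, V) ∞ X]`. -/

namespace DLDP

/-! ### Submanifolds and fiber bundles -/

section Submanifold

variable {V H X : Type*} [NormedAddCommGroup V] [NormedSpace ℝ V] [TopologicalSpace H]
  [TopologicalSpace X] [ChartedSpace H X]

/-- `S` is a regular (embedded) submanifold of `X`: around each of its points there is a chart of
`X` in which `S` is an affine subspace. -/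
def IsRegularSubmanifold (I : ModelWithCorners ℝ V H) (S : Set X) : Prop :=
  ∀ x ∈ S, ∃ e ∈ IsManifold.maximalAtlas I ∞ X, x ∈ e.source ∧
    ∃ W : Submodule ℝ V, ∀ y ∈ e.source, (y ∈ S ↔ I (e y) - I (e x) ∈ W)

end Submanifold

section Bundles

variable (EE EM EF EG EB : Type*)
  [NormedAddCommGroup EE] [NormedSpace ℝ EE] [NormedAddCommGroup EM] [NormedSpace ℝ EM]
  [NormedAddCommGroup EF] [NormedSpace ℝ EF] [NormedAddCommGroup EG] [NormedSpace ℝ EG]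
  [NormedAddCommGroup EB] [NormedSpace ℝ EB]
  {E M : Type*} [TopologicalSpace E] [ChartedSpace EE E] [TopologicalSpace M] [ChartedSpace EM M]
  (F : Type*) [TopologicalSpace F] [ChartedSpace EF F]
  (G : Type*) [TopologicalSpace G] [ChartedSpace EG G]

/-- A local trivialization which is a diffeomorphism. -/
structure SmoothTriv (φ : E → M) extends Bundle.Trivialization F φ where
  smooth_toFun : ContMDiffOn 𝓘(ℝ, EE) (𝓘(ℝ, EM).prod 𝓘(ℝ, EF)) ∞
    toOpenPartialHomeomorph toOpenPartialHomeomorph.source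
  smooth_invFun : ContMDiffOn (𝓘(ℝ, EM).prod 𝓘(ℝ, EF)) 𝓘(ℝ, EE) ∞
    toOpenPartialHomeomorph.symm toOpenPartialHomeomorph.target

/-- `(E, M, φ, F)` is a smooth fiber bundle. -/
def IsSmoothFiberBundle (φ : E → M) : Prop :=
  ∀ m : M, ∃ e : SmoothTriv EE EM EF F φ, m ∈ e.baseSet

variable [Group G]

/-- The quotient map `π^{M,G} : M → M/G`. -/
def orbitProj (M : Type*) [MulAction G M] : M → MulAction.orbitRel.Quotient G M :=
  fun m => Quotient.mk'' m

variable (M) in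
/-- A smooth local trivialization of `π^{M,G} : M → M/G`, equivariant for the action of `G` on
`U × G` by left multiplication on the second factor. -/
structure PrincipalTriv [MulAction G M] [ChartedSpace EB (MulAction.orbitRel.Quotient G M)]
    extends SmoothTriv EM EB EG G (orbitProj G M) where
  equivariant : ∀ (g : G) (m : M), m ∈ toOpenPartialHomeomorph.source →
    (toOpenPartialHomeomorph (g • m)).2 = g * (toOpenPartialHomeomorph m).2

/-- A smooth local trivialization of `φ : E → M` over a `G`-invariant open set `U`, equivariant for
the left action `g · (m, f) = (g m, r_{g⁻¹} f)` on `U × F`; the right action `r^F` is given as an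
action of the opposite group, `r_g f = op g • f`. -/
structure EquivariantTriv [MulAction G E] [MulAction G M] [MulAction Gᵐᵒᵖ F] (φ : E → M)
    extends SmoothTriv EE EM EF F φ where
  invariant : ∀ (g : G), ∀ m ∈ baseSet, g • m ∈ baseSet
  equivariant : ∀ (g : G) (ε : E), ε ∈ toOpenPartialHomeomorph.source →
    (toOpenPartialHomeomorph (g • ε)).2 =
      MulOpposite.op g⁻¹ • (toOpenPartialHomeomorph ε).2

/-- The Lie group `G` acts on the fiber bundle `(E, M, φ, F)`. The manifold structure on the orbit
space `M/G` is the one of the principal bundle `π^{M,G} : M → M/G`. -/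
class ActsOnFiberBundle [MulAction G E] [MulAction G M] [MulAction Gᵐᵒᵖ F]
    [ChartedSpace EB (MulAction.orbitRel.Quotient G M)] (φ : E → M) : Prop where
  smooth_smul_total : ContMDiff (𝓘(ℝ, EG).prod 𝓘(ℝ, EE)) 𝓘(ℝ, EE) ∞ fun p : G × E => p.1 • p.2
  smooth_smul_base : ContMDiff (𝓘(ℝ, EG).prod 𝓘(ℝ, EM)) 𝓘(ℝ, EM) ∞ fun p : G × M => p.1 • p.2
  smooth_smul_fiber : ContMDiff (𝓘(ℝ, EG).prod 𝓘(ℝ, EF)) 𝓘(ℝ, EF) ∞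
    fun p : G × F => MulOpposite.op p.1 • p.2
  free_total : ∀ (g : G) (ε : E), g • ε = ε → g = 1
  free_base : ∀ (g : G) (m : M), g • m = m → g = 1
  principal : ∀ b : MulAction.orbitRel.Quotient G M,
    ∃ e : PrincipalTriv EM EG EB M G, b ∈ e.baseSet
  equivariant : ∀ (g : G) (ε : E), φ (g • ε) = g • φ ε
  trivialization : ∀ m : M, ∃ e : EquivariantTriv EE EM EF F G φ, m ∈ e.baseSet

end Bundles

/-! ### The conjugate bundle -/

section ConjBundle

variable (G : Type*) [Group G]

/-- The orbits of the action `g · (ε, h) = (g ε, g h g⁻¹)` of `G` on `E × G`. -/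
def conjSetoid (E : Type*) [MulAction G E] : Setoid (E × G) where
  r x y := ∃ g : G, g • x.1 = y.1 ∧ g * x.2 * g⁻¹ = y.2
  iseqv :=
    { refl := fun x => ⟨1, by simp⟩
      symm := by
        rintro x y ⟨g, h1, h2⟩
        exact ⟨g⁻¹, by simp [← h1], by simp [← h2, mul_assoc]⟩
      trans := by
        rintro x y z ⟨g, h1, h2⟩ ⟨k, h3, h4⟩
        exact ⟨k * g, by rw [← h3, ← h1, mul_smul], by simp [← h4, ← h2, mul_assoc]⟩ }

/-- The total space `(E × G)/G` of the conjugate bundle of `φ : E → M` (with fiber `F`). The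
arguments `F` and `φ` and the model spaces `EE` of `E` and `EM` of `M` only serve to find its
manifold structure. -/
def ConjBundle (_EE _EM _F : Type*) {E M : Type*} [MulAction G E] (_φ : E → M) : Type _ :=
  Quotient (conjSetoid G E)

variable (EE EM F : Type*) {E M : Type*} [MulAction G E] (φ : E → M)

/-- The quotient map `π^{E×G,G} : E × G → (E × G)/G`. -/
def ConjBundle.mk (x : E × G) : ConjBundle G EE EM F φ := Quotient.mk (conjSetoid G E) x

instance [TopologicalSpace E] [TopologicalSpace G] : TopologicalSpace (ConjBundle G EE EM F φ) :=
  inferInstanceAs (TopologicalSpace (Quotient (conjSetoid G E)))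

theorem ConjBundle.isQuotientMap_mk [TopologicalSpace E] [TopologicalSpace G] :
    Topology.IsQuotientMap (ConjBundle.mk G EE EM F φ) := isQuotientMap_quotient_mk'

theorem ConjBundle.mk_eq_mk {x y : E × G} : ConjBundle.mk G EE EM F φ x = ConjBundle.mk G EE EM F φ y ↔
    ∃ g : G, g • x.1 = y.1 ∧ g * x.2 * g⁻¹ = y.2 := Quotient.eq (r := conjSetoid G E)

end ConjBundle

section ConjBundleCharts

variable {EE EM EF EG EB : Type*}
  [NormedAddCommGroup EE] [NormedSpace ℝ EE] [NormedAddCommGroup EM] [NormedSpace ℝ EM]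
  [NormedAddCommGroup EF] [NormedSpace ℝ EF] [NormedAddCommGroup EG] [NormedSpace ℝ EG]
  [NormedAddCommGroup EB] [NormedSpace ℝ EB]
  {E M F G : Type*} [TopologicalSpace E] [ChartedSpace EE E] [TopologicalSpace M]
  [ChartedSpace EM M] [TopologicalSpace F] [ChartedSpace EF F]
  [TopologicalSpace G] [ChartedSpace EG G] [Group G] [LieGroup 𝓘(ℝ, EG) ∞ G]
  [MulAction G E] [MulAction G M] [MulAction Gᵐᵒᵖ F]
  [ChartedSpace EB (MulAction.orbitRel.Quotient G M)]
  {φ : E → M}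

theorem orbitProj_smul (g : G) (m : M) : orbitProj G M (g • m) = orbitProj G M m :=
  Quotient.sound (s := MulAction.orbitRel G M) ⟨g, rfl⟩

theorem ActsOnFiberBundle.contMDiff_phi (hA : ActsOnFiberBundle EE EM EF EG EB F G φ) :
    ContMDiff 𝓘(ℝ, EE) 𝓘(ℝ, EM) ∞ φ := by
  intro ε
  obtain ⟨e, he⟩ := hA.trivialization (φ ε)
  have hs : ε ∈ e.toOpenPartialHomeomorph.source := e.mem_source.2 he
  have h1 := (e.smooth_toFun ε hs).contMDiffAt (e.toOpenPartialHomeomorph.open_source.mem_nhds hs)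
  refine (contMDiffAt_fst.comp ε h1).congr_of_eventuallyEq ?_
  filter_upwards [e.toOpenPartialHomeomorph.open_source.mem_nhds hs] with z hz
  exact (e.proj_toFun z hz).symm

theorem ActsOnFiberBundle.contMDiff_orbitProj
    (hA : ActsOnFiberBundle EE EM EF EG EB F G φ) :
    ContMDiff 𝓘(ℝ, EM) 𝓘(ℝ, EB) ∞ (orbitProj G M) := by
  intro m
  obtain ⟨e, he⟩ := hA.principal (orbitProj G M m)
  have hs : m ∈ e.toOpenPartialHomeomorph.source := e.mem_source.2 he
  have h1 := (e.smooth_toFun m hs).contMDiffAt (e.toOpenPartialHomeomorph.open_source.mem_nhds hs)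
  refine (contMDiffAt_fst.comp m h1).congr_of_eventuallyEq ?_
  filter_upwards [e.toOpenPartialHomeomorph.open_source.mem_nhds hs] with z hz
  exact (e.proj_toFun z hz).symm

variable [hA : ActsOnFiberBundle EE EM EF EG EB F G φ]

variable (EE EM EF EG EB F G φ) in
/-- The projection `p^{M/G} : (E × G)/G → M/G`, `[ε, h] ↦ π^{M,G}(φ(ε))`. -/
def ConjBundle.proj : ConjBundle G EE EM F φ → MulAction.orbitRel.Quotient G M :=
  Quotient.lift (fun x : E × G => orbitProj G M (φ x.1)) (by
    rintro x y ⟨g, h1, -⟩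
    simp only [← h1, hA.equivariant g, orbitProj_smul])

/-- The local section `b ↦ eP⁻¹(b, 1)` of `π^{M,G}`. -/
def PrincipalTriv.sect (eP : PrincipalTriv EM EG EB M G)
    (b : MulAction.orbitRel.Quotient G M) : M :=
  eP.toOpenPartialHomeomorph.symm (b, 1)

/-- The open subset of `M/G` over which the two trivializations give one of the conjugate
bundle. -/
def conjBase (eP : PrincipalTriv EM EG EB M G) (eF : EquivariantTriv EE EM EF F G φ) :
    Set (MulAction.orbitRel.Quotient G M) :=
  eP.baseSet ∩ eP.sect ⁻¹' eF.baseSet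

/-- The map `E × G → M/G × F × G` which moves `(ε, h)` along its orbit until `ε` lies over the
section of `eP` and then trivializes. -/
def conjFwd (eP : PrincipalTriv EM EG EB M G) (eF : EquivariantTriv EE EM EF F G φ) (x : E × G) :
    MulAction.orbitRel.Quotient G M × F × G :=
  (orbitProj G M (φ x.1),
    (eF.toOpenPartialHomeomorph ((eP.toOpenPartialHomeomorph (φ x.1)).2⁻¹ • x.1)).2,
    (eP.toOpenPartialHomeomorph (φ x.1)).2⁻¹ * x.2 * (eP.toOpenPartialHomeomorph (φ x.1)).2)

/-- The map `(b, f, h) ↦ (eF⁻¹(s(b), f), h)`, where `s` is the section of `eP`. -/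
def conjBwd (eP : PrincipalTriv EM EG EB M G) (eF : EquivariantTriv EE EM EF F G φ)
    (y : MulAction.orbitRel.Quotient G M × F × G) : E × G :=
  (eF.toOpenPartialHomeomorph.symm (eP.sect y.1, y.2.1), y.2.2)

section

variable (eP : PrincipalTriv EM EG EB M G) (eF : EquivariantTriv EE EM EF F G φ)

theorem PrincipalTriv.sect_mem {b : MulAction.orbitRel.Quotient G M} (hb : b ∈ eP.baseSet) :
    eP.sect b ∈ eP.toOpenPartialHomeomorph.source :=
  eP.map_target (eP.mem_target.2 hb)

theorem PrincipalTriv.apply_sect {b : MulAction.orbitRel.Quotient G M} (hb : b ∈ eP.baseSet) :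
    eP.toOpenPartialHomeomorph (eP.sect b) = (b, 1) :=
  eP.toOpenPartialHomeomorph.right_inv (eP.mem_target.2 hb)

theorem PrincipalTriv.proj_sect {b : MulAction.orbitRel.Quotient G M} (hb : b ∈ eP.baseSet) :
    orbitProj G M (eP.sect b) = b :=
  eP.proj_symm_apply' hb

theorem PrincipalTriv.inv_smul_eq_sect {m : M} (hm : orbitProj G M m ∈ eP.baseSet) :
    (eP.toOpenPartialHomeomorph m).2⁻¹ • m = eP.sect (orbitProj G M m) := by
  have h1 : m ∈ eP.toOpenPartialHomeomorph.source := eP.mem_source.2 hm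
  have h2 : (eP.toOpenPartialHomeomorph m).2⁻¹ • m ∈ eP.toOpenPartialHomeomorph.source :=
    eP.mem_source.2 (by rwa [orbitProj_smul])
  refine eP.toOpenPartialHomeomorph.injOn h2 (eP.sect_mem hm) ?_
  rw [eP.apply_sect hm]
  refine Prod.ext ?_ ?_
  · exact (eP.proj_toFun _ h2).trans (orbitProj_smul _ _)
  · rw [eP.equivariant _ _ h1, inv_mul_cancel]

theorem PrincipalTriv.contMDiffOn_sect :
    ContMDiffOn 𝓘(ℝ, EB) 𝓘(ℝ, EM) ∞ eP.sect eP.baseSet :=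
  eP.smooth_invFun.comp (contMDiffOn_id.prodMk contMDiffOn_const)
    (fun _ hb => eP.mem_target.2 hb)

theorem isOpen_conjBase : IsOpen (conjBase eP eF) :=
  eP.contMDiffOn_sect.continuousOn.isOpen_inter_preimage eP.open_baseSet eF.open_baseSet

theorem conjFwd_congr {x y : E × G} (hx : orbitProj G M (φ x.1) ∈ conjBase eP eF)
    (h : ConjBundle.mk G EE EM F φ x = ConjBundle.mk G EE EM F φ y) :
    conjFwd eP eF x = conjFwd eP eF y := by
  obtain ⟨g, h1, h2⟩ := (ConjBundle.mk_eq_mk G EE EM F φ).1 h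
  have h3 := eP.equivariant g (φ x.1) (eP.mem_source.2 hx.1)
  simp only [conjFwd, ← h1, ← h2, hA.equivariant, orbitProj_smul, h3, mul_inv_rev, smul_smul,
    mul_assoc, inv_mul_cancel, mul_one, inv_mul_cancel_left]

theorem conjFwd_conjBwd {y : MulAction.orbitRel.Quotient G M × F × G}
    (hy : y.1 ∈ conjBase eP eF) : conjFwd eP eF (conjBwd eP eF y) = y := by
  have h1 : φ (conjBwd eP eF y).1 = eP.sect y.1 := eF.proj_symm_apply' hy.2
  have h2 : eF.toOpenPartialHomeomorph (conjBwd eP eF y).1 = (eP.sect y.1, y.2.1) :=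
    eF.toOpenPartialHomeomorph.right_inv (eF.mem_target.2 hy.2)
  simp only [conjFwd, h1, eP.proj_sect hy.1, eP.apply_sect hy.1, inv_one, one_smul, h2]
  simp [conjBwd]

theorem phi_inv_smul {ε : E} (hx : orbitProj G M (φ ε) ∈ conjBase eP eF) :
    φ ((eP.toOpenPartialHomeomorph (φ ε)).2⁻¹ • ε) = eP.sect (orbitProj G M (φ ε)) := by
  rw [hA.equivariant, eP.inv_smul_eq_sect hx.1]

theorem mk_conjBwd_conjFwd {x : E × G} (hx : orbitProj G M (φ x.1) ∈ conjBase eP eF) :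
    ConjBundle.mk G EE EM F φ (conjBwd eP eF (conjFwd eP eF x)) = ConjBundle.mk G EE EM F φ x := by
  rw [ConjBundle.mk_eq_mk]
  refine ⟨(eP.toOpenPartialHomeomorph (φ x.1)).2, ?_, ?_⟩
  · have h1 := phi_inv_smul eP eF hx
    have h2 : (eP.toOpenPartialHomeomorph (φ x.1)).2⁻¹ • x.1 ∈ eF.toOpenPartialHomeomorph.source :=
      eF.mem_source.2 (by rw [h1]; exact hx.2)
    have h3 := eF.toOpenPartialHomeomorph.left_inv h2
    have h4 := eF.mk_proj_snd h2
    rw [h1] at h4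
    simp only [conjBwd, conjFwd]
    erw [h4]
    rw [Bundle.Trivialization.coe_coe] at h3
    erw [h3]
    rw [smul_inv_smul]
  · simp [conjBwd, conjFwd, mul_assoc]

theorem contMDiffOn_conjFwd :
    ContMDiffOn (𝓘(ℝ, EE).prod 𝓘(ℝ, EG)) (𝓘(ℝ, EB).prod (𝓘(ℝ, EF).prod 𝓘(ℝ, EG))) ∞
      (conjFwd eP eF) {x | orbitProj G M (φ x.1) ∈ conjBase eP eF} := by
  have hφ : ContMDiff (𝓘(ℝ, EE).prod 𝓘(ℝ, EG)) 𝓘(ℝ, EM) ∞ (fun x : E × G => φ x.1) :=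
    hA.contMDiff_phi.comp contMDiff_fst
  have hg : ContMDiffOn (𝓘(ℝ, EE).prod 𝓘(ℝ, EG)) 𝓘(ℝ, EG) ∞
      (fun x : E × G => (eP.toOpenPartialHomeomorph (φ x.1)).2)
      {x | orbitProj G M (φ x.1) ∈ conjBase eP eF} :=
    contMDiff_snd.comp_contMDiffOn
      (eP.smooth_toFun.comp hφ.contMDiffOn fun x hx => eP.mem_source.2 hx.1)
  refine ((hA.contMDiff_orbitProj.comp hφ).contMDiffOn).prodMk
    (ContMDiffOn.prodMk ?_ ((hg.inv.mul contMDiffOn_snd).mul hg))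
  refine contMDiff_snd.comp_contMDiffOn (eF.smooth_toFun.comp
    (hA.smooth_smul_total.comp_contMDiffOn (hg.inv.prodMk contMDiffOn_fst)) ?_)
  intro x hx
  refine eF.mem_source.2 ?_
  change φ ((eP.toOpenPartialHomeomorph (φ x.1)).2⁻¹ • x.1) ∈ _
  rw [phi_inv_smul eP eF hx]
  exact hx.2

theorem contMDiffOn_conjBwd :
    ContMDiffOn (𝓘(ℝ, EB).prod (𝓘(ℝ, EF).prod 𝓘(ℝ, EG))) (𝓘(ℝ, EE).prod 𝓘(ℝ, EG)) ∞
      (conjBwd eP eF) (conjBase eP eF ×ˢ univ) := by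
  refine ContMDiffOn.prodMk (eF.smooth_invFun.comp (ContMDiffOn.prodMk
    (eP.contMDiffOn_sect.comp contMDiffOn_fst fun y hy => hy.1.1)
    (contMDiff_fst.comp contMDiff_snd).contMDiffOn) ?_)
    (contMDiff_snd.comp contMDiff_snd).contMDiffOn
  intro y hy
  exact eF.mem_target.2 hy.1.2

/-- The local trivialization of the conjugate bundle, with fiber `F × G`, given by local
trivializations of `π^{M,G}` and of `φ`. -/
def conjTriv : OpenPartialHomeomorph (ConjBundle G EE EM F φ)
    (MulAction.orbitRel.Quotient G M × F × G) where
  toFun v := conjFwd eP eF (Quotient.out v)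
  invFun y := ConjBundle.mk G EE EM F φ (conjBwd eP eF y)
  source := ConjBundle.proj EE EM EF EG EB F G φ ⁻¹' conjBase eP eF
  target := conjBase eP eF ×ˢ univ
  map_source' := by
    intro v hv
    rw [← Quotient.out_eq v] at hv
    exact ⟨hv, trivial⟩
  map_target' := by
    intro y hy
    have h1 : φ (conjBwd eP eF y).1 = eP.sect y.1 := eF.proj_symm_apply' hy.1.2
    change orbitProj G M (φ (conjBwd eP eF y).1) ∈ conjBase eP eF
    rw [h1, eP.proj_sect hy.1.1]
    exact hy.1
  left_inv' := by
    intro v hv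
    rw [← Quotient.out_eq v] at hv
    exact (mk_conjBwd_conjFwd eP eF hv).trans (Quotient.out_eq v)
  right_inv' := by
    intro y hy
    have h1 : φ (conjBwd eP eF y).1 = eP.sect y.1 := eF.proj_symm_apply' hy.1.2
    rw [← conjFwd_congr (F := F) eP eF (x := conjBwd eP eF y) (by
      rw [h1, eP.proj_sect hy.1.1]; exact hy.1) (Quotient.out_eq _).symm]
    exact conjFwd_conjBwd eP eF hy.1
  open_source := by
    rw [← (ConjBundle.isQuotientMap_mk G EE EM F φ).isOpen_preimage]
    exact (isOpen_conjBase eP eF).preimage (hA.contMDiff_orbitProj.continuous.comp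
      (hA.contMDiff_phi.continuous.comp continuous_fst))
  open_target := (isOpen_conjBase eP eF).prod isOpen_univ
  continuousOn_toFun := by
    have ho : IsOpen (ConjBundle.proj EE EM EF EG EB F G φ ⁻¹' conjBase eP eF) := by
      rw [← (ConjBundle.isQuotientMap_mk G EE EM F φ).isOpen_preimage]
      exact (isOpen_conjBase eP eF).preimage
        (hA.contMDiff_orbitProj.continuous.comp
          (hA.contMDiff_phi.continuous.comp continuous_fst))
    rw [(ConjBundle.isQuotientMap_mk G EE EM F φ).continuousOn_isOpen_iff ho]
    refine (contMDiffOn_conjFwd eP eF).continuousOn.congr ?_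
    intro x hx
    exact (conjFwd_congr (F := F) eP eF hx (Quotient.out_eq _).symm).symm
  continuousOn_invFun := by
    refine (ConjBundle.isQuotientMap_mk G EE EM F φ).continuous.comp_continuousOn ?_
    exact (contMDiffOn_conjBwd eP eF).continuousOn

end

variable (EE EM EF EG EB F G φ) in
/-- The charts of the conjugate bundle: local trivializations followed by charts of
`M/G × F × G`. -/
def conjAtlas : Set (OpenPartialHomeomorph (ConjBundle G EE EM F φ) (EB × EF × EG)) :=
  {c | ∃ (eP : PrincipalTriv EM EG EB M G) (eF : EquivariantTriv EE EM EF F G φ),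
    ∃ cB ∈ atlas EB (MulAction.orbitRel.Quotient G M), ∃ cF ∈ atlas EF F, ∃ cG ∈ atlas EG G,
      c = conjTriv eP eF ≫ₕ cB.prod (cF.prod cG)}

variable (EE EM EF EG EB F G φ) in
theorem exists_mem_conjAtlas (v : ConjBundle G EE EM F φ) :
    ∃ c ∈ conjAtlas EE EM EF EG EB F G φ, v ∈ c.source := by
  obtain ⟨eP, hP⟩ := hA.principal (ConjBundle.proj EE EM EF EG EB F G φ v)
  obtain ⟨eF, hF⟩ := hA.trivialization (eP.sect (ConjBundle.proj EE EM EF EG EB F G φ v))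
  have hv : v ∈ (conjTriv eP eF).source := ⟨hP, hF⟩
  refine ⟨_, ⟨eP, eF, _, chart_mem_atlas EB (conjTriv eP eF v).1, _,
    chart_mem_atlas EF (conjTriv eP eF v).2.1, _, chart_mem_atlas EG (conjTriv eP eF v).2.2, rfl⟩,
    ?_⟩
  rw [OpenPartialHomeomorph.trans_source]
  exact ⟨hv, mem_chart_source _ _, mem_chart_source _ _, mem_chart_source _ _⟩

instance conjChartedSpace : ChartedSpace (EB × EF × EG) (ConjBundle G EE EM F φ) where
  atlas := conjAtlas EE EM EF EG EB F G φ
  chartAt v := (exists_mem_conjAtlas EE EM EF EG EB F G φ v).choose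
  mem_chart_source v := (exists_mem_conjAtlas EE EM EF EG EB F G φ v).choose_spec.2
  chart_mem_atlas v := (exists_mem_conjAtlas EE EM EF EG EB F G φ v).choose_spec.1

theorem contMDiffOn_prodChart [IsManifold 𝓘(ℝ, EB) ∞ (MulAction.orbitRel.Quotient G M)]
    [IsManifold 𝓘(ℝ, EF) ∞ F] {cB : OpenPartialHomeomorph (MulAction.orbitRel.Quotient G M) EB}
    {cF : OpenPartialHomeomorph F EF} {cG : OpenPartialHomeomorph G EG}
    (hB : cB ∈ atlas EB (MulAction.orbitRel.Quotient G M)) (hF : cF ∈ atlas EF F)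
    (hG : cG ∈ atlas EG G) :
    ContMDiffOn (𝓘(ℝ, EB).prod (𝓘(ℝ, EF).prod 𝓘(ℝ, EG))) 𝓘(ℝ, EB × EF × EG) ∞
      (cB.prod (cF.prod cG)) (cB.prod (cF.prod cG)).source ∧
    ContMDiffOn 𝓘(ℝ, EB × EF × EG) (𝓘(ℝ, EB).prod (𝓘(ℝ, EF).prod 𝓘(ℝ, EG))) ∞
      (cB.prod (cF.prod cG)).symm (cB.prod (cF.prod cG)).target := by
  have hGm : IsManifold 𝓘(ℝ, EG) ∞ G := LieGroup.toContMDiffMul.toIsManifold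
  have hB' := IsManifold.subset_maximalAtlas (I := 𝓘(ℝ, EB)) (n := ∞) hB
  have hF' := IsManifold.subset_maximalAtlas (I := 𝓘(ℝ, EF)) (n := ∞) hF
  have hG' := IsManifold.subset_maximalAtlas (I := 𝓘(ℝ, EG)) (n := ∞) hG
  constructor
  · refine ContMDiffOn.prodMk_space
      ((contMDiffOn_of_mem_maximalAtlas hB').comp contMDiffOn_fst fun y hy => hy.1)
      (ContMDiffOn.prodMk_space
        ((contMDiffOn_of_mem_maximalAtlas hF').comp
          (contMDiff_fst.comp contMDiff_snd).contMDiffOn fun y hy => hy.2.1)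
        ((contMDiffOn_of_mem_maximalAtlas hG').comp
          (contMDiff_snd.comp contMDiff_snd).contMDiffOn fun y hy => hy.2.2))
  · refine ContMDiffOn.prodMk
      ((contMDiffOn_symm_of_mem_maximalAtlas hB').comp
        contDiff_fst.contMDiff.contMDiffOn fun y hy => hy.1)
      (ContMDiffOn.prodMk
        ((contMDiffOn_symm_of_mem_maximalAtlas hF').comp
          (contDiff_fst.comp contDiff_snd).contMDiff.contMDiffOn fun y hy => hy.2.1)
        ((contMDiffOn_symm_of_mem_maximalAtlas hG').comp
          (contDiff_snd.comp contDiff_snd).contMDiff.contMDiffOn fun y hy => hy.2.2))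

/-- The conjugate bundle is a smooth manifold. -/
instance conjIsManifold [IsManifold 𝓘(ℝ, EB) ∞ (MulAction.orbitRel.Quotient G M)]
    [IsManifold 𝓘(ℝ, EF) ∞ F] :
    IsManifold 𝓘(ℝ, EB × EF × EG) ∞ (ConjBundle G EE EM F φ) := by
  refine isManifold_of_contDiffOn _ _ _ ?_
  rintro _ _ ⟨eP, eF, cB, hB, cF, hF, cG, hG, rfl⟩ ⟨eP', eF', cB', hB', cF', hF', cG', hG', rfl⟩
  rw [← contMDiffOn_iff_contDiffOn]
  have h1 := (contMDiffOn_prodChart hB hF hG).2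
  have h2 := (contMDiffOn_prodChart hB' hF' hG').1
  have h3 := contMDiffOn_conjBwd eP eF
  have h4 := contMDiffOn_conjFwd eP' eF'
  have key : ∀ y ∈ (conjTriv eP eF).target, (conjTriv eP eF).symm y ∈ (conjTriv eP' eF').source →
      orbitProj G M (φ (conjBwd eP eF y).1) ∈ conjBase eP' eF' ∧
      conjTriv eP' eF' ((conjTriv eP eF).symm y) = conjFwd eP' eF' (conjBwd eP eF y) := by
    intro y _ hy'
    exact ⟨hy', (conjFwd_congr (F := F) eP' eF' hy' (Quotient.out_eq _).symm).symm⟩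
  have hz : ∀ z ∈ 𝓘(ℝ, EB × EF × EG).symm ⁻¹'
      ((conjTriv eP eF ≫ₕ cB.prod (cF.prod cG)).symm ≫ₕ
        conjTriv eP' eF' ≫ₕ cB'.prod (cF'.prod cG')).source ∩ range 𝓘(ℝ, EB × EF × EG),
      z ∈ (cB.prod (cF.prod cG)).target ∧
      (cB.prod (cF.prod cG)).symm z ∈ (conjTriv eP eF).target ∧
      (conjTriv eP eF).symm ((cB.prod (cF.prod cG)).symm z) ∈ (conjTriv eP' eF').source ∧
      conjTriv eP' eF' ((conjTriv eP eF).symm ((cB.prod (cF.prod cG)).symm z)) ∈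
        (cB'.prod (cF'.prod cG')).source := by
    rintro z ⟨hz, -⟩
    have h5 : z ∈ (conjTriv eP eF ≫ₕ cB.prod (cF.prod cG)).target := hz.1
    rw [OpenPartialHomeomorph.trans_target] at h5
    have h6 := hz.2
    exact ⟨h5.1, h5.2, h6.1, h6.2⟩
  refine ((h2.comp (h4.comp (h3.comp (h1.mono ?_) ?_) ?_) ?_)).congr ?_
  · exact fun z h => (hz z h).1
  · exact fun z h => (hz z h).2.1
  · exact fun z h => (key _ (hz z h).2.1 (hz z h).2.2.1).1
  · intro z h
    have h5 := (hz z h).2.2.2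
    rw [(key _ (hz z h).2.1 (hz z h).2.2.1).2] at h5
    exact h5
  · intro z h
    exact congrArg (cB'.prod (cF'.prod cG')) (key _ (hz z h).2.1 (hz z h).2.2.1).2

end ConjBundleCharts

/-! ### Discrete Lagrange--D'Alembert--Poincaré systems -/

/-- The data of a discrete Lagrange--D'Alembert--Poincaré system over `φ : E → M`, with
`C'(E) = E × M`. Here `EE` and `_EM` are the model
spaces of `E` and `M`. A vector `(δε, 0)` of `p₁^*(TE) ⊆ T(C'(E))` is written as `δε`. -/
structure DLDPSData (EE _EM : Type*) [NormedAddCommGroup EE] [NormedSpace ℝ EE] {E M : Type*}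
    [TopologicalSpace E] [ChartedSpace EE E] (_φ : E → M) where
  /-- The discrete Lagrangian. -/
  L : E × M → ℝ
  /-- The kinematic constraints. -/
  Dd : Set (E × M)
  /-- The variational constraints, a subbundle of `p₁^*(TE)`. -/
  D : (x : E × M) → Submodule ℝ (TangentSpace 𝓘(ℝ, EE) x.1)
  /-- The chaining map: for `(x, y) ∈ C''(E)` and `δε ∈ D y`, the vector `P x y δε` is
  `𝒫(x, y)(δε, 0)`. Other values play no role. -/
  P : (x y : E × M) → TangentSpace 𝓘(ℝ, EE) y.1 → TangentSpace 𝓘(ℝ, EE) x.1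

section Systems

variable (EE EM : Type*)
  [NormedAddCommGroup EE] [NormedSpace ℝ EE] [NormedAddCommGroup EM] [NormedSpace ℝ EM]
  {E M : Type*} [TopologicalSpace E] [ChartedSpace EE E] [TopologicalSpace M] [ChartedSpace EM M]

/-- `(x, y)` lies in the discrete second order manifold `C''(E)`. -/
def Chained (φ : E → M) (x y : E × M) : Prop := x.2 = φ y.1

/-- A discrete path in `C'(E)`, where `x k` stands for `(ε_k, m_{k+1})`. -/
def IsDiscretePath (φ : E → M) {N : ℕ} (x : Fin N → E × M) : Prop :=
  ∀ (k : ℕ) (hk : k + 1 < N), Chained φ (x ⟨k, Nat.lt_of_succ_lt hk⟩) (x ⟨k + 1, hk⟩)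

namespace DLDPSData

variable {EE EM} {φ : E → M} (S : DLDPSData EE EM φ)

/-- The data form a discrete Lagrange--D'Alembert--Poincaré system over the fiber bundle
`(E, M, φ, F)`. -/
structure IsDLDPS (EF : Type*) [NormedAddCommGroup EF] [NormedSpace ℝ EF] (F : Type*)
    [TopologicalSpace F] [ChartedSpace EF F] [IsManifold 𝓘(ℝ, EE) ∞ E] : Prop where
  fiberBundle : IsSmoothFiberBundle EE EM EF F φ
  smooth_L : ContMDiff (𝓘(ℝ, EE).prod 𝓘(ℝ, EM)) 𝓘(ℝ, ℝ) ∞ S.L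
  submanifold_Dd : IsRegularSubmanifold (𝓘(ℝ, EE).prod 𝓘(ℝ, EM)) S.Dd
  /-- `D` has smooth local frames. -/
  subbundle_D : ∀ x : E × M, ∃ U : Set (E × M), IsOpen U ∧ x ∈ U ∧
    ∃ (d : ℕ) (σ : Fin d → (y : E × M) → TangentSpace 𝓘(ℝ, EE) y.1),
      (∀ i, ContMDiffOn (𝓘(ℝ, EE).prod 𝓘(ℝ, EM)) 𝓘(ℝ, EE).tangent ∞
        (fun y => (⟨y.1, σ i y⟩ : TangentBundle 𝓘(ℝ, EE) E)) U) ∧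
      ∀ y ∈ U, LinearIndependent ℝ (fun i => σ i y) ∧
        Submodule.span ℝ (range fun i => σ i y) = S.D y
  add_P : ∀ x y, Chained φ x y → ∀ u ∈ S.D y, ∀ v ∈ S.D y,
    S.P x y (u + v) = S.P x y u + S.P x y v
  smul_P : ∀ x y, Chained φ x y → ∀ (a : ℝ), ∀ u ∈ S.D y, S.P x y (a • u) = a • S.P x y u
  vertical_P : ∀ x y, Chained φ x y → ∀ u ∈ S.D y,
    mfderiv 𝓘(ℝ, EE) 𝓘(ℝ, EM) φ x.1 (S.P x y u) = 0
  /-- `P` is smooth: it maps smooth local sections of `D` to smooth maps; `C''(E)` is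
  parametrized by `(ε₀, y) ↦ ((ε₀, φ(p₁(y))), y)` on `E × (E × M)`. -/
  smooth_P : ∀ (U : Set (E × M)) (σ : (y : E × M) → TangentSpace 𝓘(ℝ, EE) y.1), IsOpen U →
    ContMDiffOn (𝓘(ℝ, EE).prod 𝓘(ℝ, EM)) 𝓘(ℝ, EE).tangent ∞
      (fun y => (⟨y.1, σ y⟩ : TangentBundle 𝓘(ℝ, EE) E)) U →
    (∀ y ∈ U, σ y ∈ S.D y) →
    ContMDiffOn (𝓘(ℝ, EE).prod (𝓘(ℝ, EE).prod 𝓘(ℝ, EM))) 𝓘(ℝ, EE).tangent ∞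
      (fun z : E × (E × M) =>
        (⟨z.1, S.P (z.1, φ z.2.1) z.2 (σ z.2)⟩ : TangentBundle 𝓘(ℝ, EE) E)) (univ ×ˢ U)

/-- `D₁L_d(x)(δε)`. -/
def D1L (x : E × M) (δε : TangentSpace 𝓘(ℝ, EE) x.1) : ℝ :=
  mfderiv (𝓘(ℝ, EE).prod 𝓘(ℝ, EM)) 𝓘(ℝ, ℝ) S.L x (δε, 0)

/-- `D₂L_d(x)(δm)`. -/
def D2L (x : E × M) (δm : TangentSpace 𝓘(ℝ, EM) x.2) : ℝ :=
  mfderiv (𝓘(ℝ, EE).prod 𝓘(ℝ, EM)) 𝓘(ℝ, ℝ) S.L x (0, δm)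

/-- The section of motion `ν_d(x, y)`, evaluated at `(δε, 0)` with `δε ∈ D y`. -/
def nu (x y : E × M) (δε : TangentSpace 𝓘(ℝ, EE) y.1) : ℝ :=
  S.D1L y δε + S.D2L x (mfderiv 𝓘(ℝ, EE) 𝓘(ℝ, EM) φ y.1 δε) + S.D1L x (S.P x y δε)

/-- The discrete action. -/
def action (N : ℕ) (x : Fin N → E × M) : ℝ := ∑ k, S.L (x k)

/-- Tangent vectors of `C'(E)^N` at `x`. -/
abbrev PathTangent {N : ℕ} (x : Fin N → E × M) : Type _ :=
  TangentSpace (ModelWithCorners.pi fun _ : Fin N => 𝓘(ℝ, EE).prod 𝓘(ℝ, EM)) x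

/-- The component `δε_k` of a tangent vector of `C'(E)^N`. -/
def PathTangent.dε {N : ℕ} {x : Fin N → E × M} (δ : PathTangent (EE := EE) (EM := EM) x)
    (k : Fin N) : TangentSpace 𝓘(ℝ, EE) (x k).1 :=
  ((δ : Fin N → EE × EM) k).1

/-- The component `δm_{k+1}` of a tangent vector of `C'(E)^N`. -/
def PathTangent.dm {N : ℕ} {x : Fin N → E × M} (δ : PathTangent (EE := EE) (EM := EM) x)
    (k : Fin N) : TangentSpace 𝓘(ℝ, EM) (x k).2 :=
  ((δ : Fin N → EE × EM) k).2

/-- `δ` is an infinitesimal variation over the path `x`: `δm_k = dφ(ε_k)(δε_k)` for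
`1 ≤ k ≤ N - 1`. -/
def IsVariation (_S : DLDPSData EE EM φ) {N : ℕ} (x : Fin N → E × M)
    (δ : PathTangent (EE := EE) (EM := EM) x) : Prop :=
  ∀ (k : ℕ) (hk : k + 1 < N), δ.dm ⟨k, Nat.lt_of_succ_lt hk⟩ =
    mfderiv 𝓘(ℝ, EE) 𝓘(ℝ, EM) φ (x ⟨k + 1, hk⟩).1 (δ.dε ⟨k + 1, hk⟩)

/-- `δ` is a nonholonomic infinitesimal variation with fixed endpoints over the path `x`: for some
`t k ∈ D (x k)`, `1 ≤ k ≤ N - 1`, one has `δε_k = t k + 𝒫(x k, x (k+1))(t (k+1))`, where the first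
summand is absent for `k = 0` and the second for `k = N - 1`; and `δm_N = 0`. -/
def IsFixedVariation {N : ℕ} (x : Fin N → E × M)
    (δ : PathTangent (EE := EE) (EM := EM) x) : Prop :=
  S.IsVariation x δ ∧ (∀ k : Fin N, (k : ℕ) + 1 = N → δ.dm k = 0) ∧
  ∃ t : (k : Fin N) → TangentSpace 𝓘(ℝ, EE) (x k).1,
    (∀ k : Fin N, 1 ≤ (k : ℕ) → t k ∈ S.D (x k)) ∧
    ∀ k : Fin N, δ.dε k = (if 1 ≤ (k : ℕ) then t k else 0) +
      (if hk : (k : ℕ) + 1 < N then S.P (x k) (x ⟨k + 1, hk⟩) (t ⟨k + 1, hk⟩) else 0)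

/-- `x` is a trajectory: a discrete path in the kinematic constraints on which the differential of
the discrete action vanishes on the nonholonomic variations with fixed endpoints. -/
def IsTrajectory {N : ℕ} (x : Fin N → E × M) : Prop :=
  IsDiscretePath φ x ∧ (∀ k, x k ∈ S.Dd) ∧
  ∀ δ : PathTangent (EE := EE) (EM := EM) x, S.IsFixedVariation x δ →
    mfderiv (ModelWithCorners.pi fun _ : Fin N => 𝓘(ℝ, EE).prod 𝓘(ℝ, EM)) 𝓘(ℝ, ℝ)
      (S.action N) x δ = 0

/-- The equations of motion: `x` satisfies the kinematic constraints, and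
`ν_d(x (k-1), x k) = 0` on `D (x k)` for `1 ≤ k ≤ N - 1`. -/
def SatisfiesEquations {N : ℕ} (x : Fin N → E × M) : Prop :=
  (∀ k, x k ∈ S.Dd) ∧
  ∀ (k : ℕ) (hk : k + 1 < N), ∀ δε ∈ S.D (x ⟨k + 1, hk⟩),
    S.nu (x ⟨k, Nat.lt_of_succ_lt hk⟩) (x ⟨k + 1, hk⟩) δε = 0

/-- The action of `G` on `φ : E → M` leaves `L_d`, `D_d`, `D` and `𝒫` invariant. If moreover `G`
acts on the fiber bundle `(E, M, φ, F)`, it is a symmetry group of the system. -/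
structure IsInvariant (G : Type*) [Group G] [MulAction G E] [MulAction G M] : Prop where
  invariant_L : ∀ (g : G) (x : E × M), S.L (g • x) = S.L x
  invariant_Dd : ∀ (g : G), ∀ x ∈ S.Dd, g • x ∈ S.Dd
  invariant_D : ∀ (g : G) (x : E × M), ∀ u ∈ S.D x,
    mfderiv 𝓘(ℝ, EE) 𝓘(ℝ, EE) (fun ε : E => g • ε) x.1 u ∈ S.D (g • x)
  equivariant_P : ∀ (g : G) (x y : E × M), Chained φ x y → ∀ u ∈ S.D y,
    S.P (g • x) (g • y) (mfderiv 𝓘(ℝ, EE) 𝓘(ℝ, EE) (fun ε : E => g • ε) y.1 u) =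
      mfderiv 𝓘(ℝ, EE) 𝓘(ℝ, EE) (fun ε : E => g • ε) x.1 (S.P x y u)

end DLDPSData

end Systems

/-! ### Discrete connections and reduction -/

section Reduction

variable (EE EM EF EG EB : Type*)
  [NormedAddCommGroup EE] [NormedSpace ℝ EE] [NormedAddCommGroup EM] [NormedSpace ℝ EM]
  [NormedAddCommGroup EF] [NormedSpace ℝ EF] [NormedAddCommGroup EG] [NormedSpace ℝ EG]
  [NormedAddCommGroup EB] [NormedSpace ℝ EB]
  (E M F G : Type*) [TopologicalSpace E] [ChartedSpace EE E] [TopologicalSpace M]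
  [ChartedSpace EM M] [TopologicalSpace F] [ChartedSpace EF F]
  [TopologicalSpace G] [ChartedSpace EG G] [Group G]
  [MulAction G E] [MulAction G M] [MulAction Gᵐᵒᵖ F]
  [ChartedSpace EB (MulAction.orbitRel.Quotient G M)]

/-- An (affine) discrete connection on `π^{M,G} : M → M/G`, with level `γ`. -/
structure DiscreteConnection where
  level : M → G
  Hor : Set (M × M)
  smooth_level : ContMDiff 𝓘(ℝ, EM) 𝓘(ℝ, EG) ∞ level
  equivariant_level : ∀ (g : G) (q : M), level (g • q) = g * level q * g⁻¹
  submanifold : IsRegularSubmanifold (𝓘(ℝ, EM).prod 𝓘(ℝ, EM)) Hor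
  invariant : ∀ (g : G), ∀ p ∈ Hor, g • p ∈ Hor
  level_mem : ∀ q : M, (q, level q • q) ∈ Hor
  injective : InjOn (Prod.map id (orbitProj G M)) Hor
  /-- The restriction of `id × π^{M,G}` to `Hor` is a local diffeomorphism. -/
  localDiffeo : ∀ p ∈ Hor, ∃ (W : Set (M × M)) (V : Set (M × MulAction.orbitRel.Quotient G M))
    (s : M × MulAction.orbitRel.Quotient G M → M × M),
    IsOpen W ∧ p ∈ W ∧ IsOpen V ∧
    MapsTo (Prod.map id (orbitProj G M)) (Hor ∩ W) V ∧ MapsTo s V (Hor ∩ W) ∧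
    InvOn s (Prod.map id (orbitProj G M)) (Hor ∩ W) V ∧
    ContMDiffOn (𝓘(ℝ, EM).prod 𝓘(ℝ, EB)) (𝓘(ℝ, EM).prod 𝓘(ℝ, EM)) ∞ s V

variable {EE EM EF EG EB E M F G}

namespace DiscreteConnection

variable (A : DiscreteConnection EM EG EB M G)

/-- The domain `𝔘` of the discrete connection. -/
def domain : Set (M × M) :=
  {p | ∃ (q : M) (g : G), (p.1, q) ∈ A.Hor ∧ p.2 = g • q}

open Classical in
/-- The discrete connection form: for `(q₀, q₁) ∈ 𝔘`, the element `g` with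
`(q₀, g⁻¹ q₁) ∈ Hor`. -/
def form (q₀ q₁ : M) : G :=
  if h : ∃ g : G, (q₀, g⁻¹ • q₁) ∈ A.Hor then h.choose else 1

/-- The domain of `Υ`. It is all of `C'(E)` if the connection is globally defined. -/
def upsilonDomain (φ : E → M) : Set (E × M) := {x | (φ x.1, x.2) ∈ A.domain}

variable (EE F) in
/-- The map `Υ(ε, m) = ([ε, A_d(φ(ε), m)], π^{M,G}(m))` from `C'(E)` to `C'((E × G)/G)`,
to be used on `upsilonDomain`. -/
def upsilon (φ : E → M) (x : E × M) :
    ConjBundle G EE EM F φ × MulAction.orbitRel.Quotient G M :=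
  (ConjBundle.mk G EE EM F φ (x.1, A.form (φ x.1) x.2), orbitProj G M x.2)

variable [LieGroup 𝓘(ℝ, EG) ∞ G] {φ : E → M} [ActsOnFiberBundle EE EM EF EG EB F G φ]

variable (EF F) in
open Classical in
/-- The reduced system `M/(G, A_d)` over the conjugate bundle. -/
def reduce (S : DLDPSData EE EM φ) :
    DLDPSData (EB × EF × EG) EB (ConjBundle.proj EE EM EF EG EB F G φ) where
  L w := if h : ∃ x ∈ A.upsilonDomain φ, A.upsilon EE F φ x = w then S.L h.choose else 0
  Dd := A.upsilon EE F φ '' (S.Dd ∩ A.upsilonDomain φ)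
  D w := Submodule.span ℝ
    {δv | ∃ x ∈ A.upsilonDomain φ, A.upsilon EE F φ x = w ∧ ∃ δε ∈ S.D x,
      mfderiv (𝓘(ℝ, EE).prod 𝓘(ℝ, EM)) (𝓘(ℝ, EB × EF × EG).prod 𝓘(ℝ, EB))
        (A.upsilon EE F φ) x (δε, 0) = (δv, 0)}
  P w z δv :=
    if h : ∃ (x y : E × M) (δε : TangentSpace 𝓘(ℝ, EE) y.1),
        x ∈ A.upsilonDomain φ ∧ y ∈ A.upsilonDomain φ ∧ Chained φ x y ∧
        A.upsilon EE F φ x = w ∧ A.upsilon EE F φ y = z ∧ δε ∈ S.D y ∧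
        mfderiv (𝓘(ℝ, EE).prod 𝓘(ℝ, EM)) (𝓘(ℝ, EB × EF × EG).prod 𝓘(ℝ, EB))
          (A.upsilon EE F φ) y (δε, 0) = (δv, 0) then
      mfderiv (𝓘(ℝ, EE).prod 𝓘(ℝ, EM)) 𝓘(ℝ, EB × EF × EG)
        (fun x' => (A.upsilon EE F φ x').1) h.choose
        (S.P h.choose h.choose_spec.choose h.choose_spec.choose_spec.choose,
          mfderiv 𝓘(ℝ, EE) 𝓘(ℝ, EM) φ h.choose_spec.choose.1
            h.choose_spec.choose_spec.choose)
    else 0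

end DiscreteConnection

end Reduction

end DLDP

end

namespace DLDP

open Filter Topology

set_option linter.unusedSectionVars false

noncomputable section

/-! ### Smoothness of the conjugate bundle -/

section ConjBundleSmooth

variable {EE EM EF EG EB : Type*}
  [NormedAddCommGroup EE] [NormedSpace ℝ EE] [NormedAddCommGroup EM] [NormedSpace ℝ EM]
  [NormedAddCommGroup EF] [NormedSpace ℝ EF] [NormedAddCommGroup EG] [NormedSpace ℝ EG]
  [NormedAddCommGroup EB] [NormedSpace ℝ EB]
  {E M F G : Type*} [TopologicalSpace E] [ChartedSpace EE E] [TopologicalSpace M]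
  [ChartedSpace EM M] [TopologicalSpace F] [ChartedSpace EF F] [IsManifold 𝓘(ℝ, EF) ∞ F]
  [TopologicalSpace G] [ChartedSpace EG G] [Group G] [LieGroup 𝓘(ℝ, EG) ∞ G]
  [MulAction G E] [MulAction G M] [MulAction Gᵐᵒᵖ F]
  [ChartedSpace EB (MulAction.orbitRel.Quotient G M)]
  [IsManifold 𝓘(ℝ, EB) ∞ (MulAction.orbitRel.Quotient G M)]
  {φ : E → M} [hA : ActsOnFiberBundle EE EM EF EG EB F G φ]

/-! The equivalence of trajectories and equations of motion is a discrete summation by parts. Along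
a variation generated by vectors `t k`, the condition δm_k = dφ(δε_k) becomes δm_k = dφ(t_k),
because the chained part of δε_k is vertical. Collecting the terms that contain t_k turns the
differential of the action into Σ ν_d(x_{k-1}, x_k)(t_k) (`sum_dL_eq_sum_nu`). The t_k range freely
over the fibers of 𝒟, so all these differentials vanish exactly when every ν_d(x_{k-1}, x_k) does.
This argument uses only differentiability of the Lagrangian at the points of the path and, between
consecutive points, 𝒫(0) = 0 and verticality of 𝒫. `isTrajectory_iff` assumes no more than that, so
it applies to the reduced system without a proof that the latter is a full system.

The two levels are compared through the equations of motion. On its domain Υ is smooth, has smooth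
local sections, and its fibers are the G-orbits (`contMDiffAt_upsilon`, `exists_section_upsilon`,
`exists_smul_of_upsilon_eq`). Hence the invariant data descend. Moreover dΥ is injective on vectors
(δε, 0) (`dupsilonFst_injective`), which makes the reduced chaining map well defined
(`chain_reduce_dupsilonFst`). The chain rule then shows that the reduced section of motion pulls
back to the original one (`nu_reduce_dupsilonFst`). Since the reduced constraint fiber is the
dΥ-image of the original fiber, the two sets of equations say the same thing. -/

theorem ConjBundle.exists_conjTriv (b : MulAction.orbitRel.Quotient G M) :
    ∃ (eP : PrincipalTriv EM EG EB M G) (eF : EquivariantTriv EE EM EF F G φ),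
      b ∈ conjBase eP eF := by
  obtain ⟨eP, hP⟩ := hA.principal b
  obtain ⟨eF, hF⟩ := hA.trivialization (eP.sect b)
  exact ⟨eP, eF, hP, hF⟩

variable (eP : PrincipalTriv EM EG EB M G) (eF : EquivariantTriv EE EM EF F G φ)

/-- The charts of the conjugate bundle are `conjTriv` followed by product charts, so `conjTriv` is
locally a chart followed by the inverse of a product chart. -/
theorem contMDiffOn_conjTriv :
    ContMDiffOn 𝓘(ℝ, EB × EF × EG) (𝓘(ℝ, EB).prod (𝓘(ℝ, EF).prod 𝓘(ℝ, EG))) ∞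
      (conjTriv eP eF) (conjTriv eP eF).source := by
  intro v hv
  have hB := chart_mem_atlas EB (conjTriv eP eF v).1
  have hF := chart_mem_atlas EF (conjTriv eP eF v).2.1
  have hG := chart_mem_atlas EG (conjTriv eP eF v).2.2
  set c := (chartAt EB (conjTriv eP eF v).1).prod
    ((chartAt EF (conjTriv eP eF v).2.1).prod (chartAt EG (conjTriv eP eF v).2.2)) with hc
  have hcs : conjTriv eP eF v ∈ c.source :=
    ⟨mem_chart_source _ _, mem_chart_source _ _, mem_chart_source _ _⟩
  have hmem : conjTriv eP eF ≫ₕ c ∈ atlas (EB × EF × EG) (ConjBundle G EE EM F φ) :=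
    ⟨eP, eF, _, hB, _, hF, _, hG, rfl⟩
  have hs : v ∈ (conjTriv eP eF ≫ₕ c).source := by
    rw [OpenPartialHomeomorph.trans_source]; exact ⟨hv, hcs⟩
  have h1 := contMDiffAt_of_mem_maximalAtlas
    (IsManifold.subset_maximalAtlas (I := 𝓘(ℝ, EB × EF × EG)) (n := ∞) hmem) hs
  have h2 := ((contMDiffOn_prodChart hB hF hG).2 _ (c.map_source hcs)).contMDiffAt
    (c.open_target.mem_nhds (c.map_source hcs))
  refine ContMDiffAt.contMDiffWithinAt ?_
  refine (ContMDiffAt.comp v (g := c.symm) (f := conjTriv eP eF ≫ₕ c) h2 h1).congr_of_eventuallyEq ?_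
  filter_upwards [(conjTriv eP eF ≫ₕ c).open_source.mem_nhds hs] with w hw
  rw [OpenPartialHomeomorph.trans_source] at hw
  exact (c.left_inv hw.2).symm

theorem contMDiffOn_conjTriv_symm :
    ContMDiffOn (𝓘(ℝ, EB).prod (𝓘(ℝ, EF).prod 𝓘(ℝ, EG))) 𝓘(ℝ, EB × EF × EG) ∞
      (conjTriv eP eF).symm (conjTriv eP eF).target := by
  intro y hy
  have hB := chart_mem_atlas EB y.1
  have hF := chart_mem_atlas EF y.2.1
  have hG := chart_mem_atlas EG y.2.2
  set c := (chartAt EB y.1).prod ((chartAt EF y.2.1).prod (chartAt EG y.2.2)) with hc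
  have hcs : y ∈ c.source := ⟨mem_chart_source _ _, mem_chart_source _ _, mem_chart_source _ _⟩
  have hmem : conjTriv eP eF ≫ₕ c ∈ atlas (EB × EF × EG) (ConjBundle G EE EM F φ) :=
    ⟨eP, eF, _, hB, _, hF, _, hG, rfl⟩
  have ht : c y ∈ (conjTriv eP eF ≫ₕ c).target := by
    rw [OpenPartialHomeomorph.trans_target]
    refine ⟨c.map_source hcs, ?_⟩
    change c.symm (c y) ∈ (conjTriv eP eF).target
    rwa [c.left_inv hcs]
  have h1 := contMDiffAt_symm_of_mem_maximalAtlas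
    (IsManifold.subset_maximalAtlas (I := 𝓘(ℝ, EB × EF × EG)) (n := ∞) hmem) ht
  have h2 := ((contMDiffOn_prodChart hB hF hG).1 _ hcs).contMDiffAt (c.open_source.mem_nhds hcs)
  refine ContMDiffAt.contMDiffWithinAt ?_
  refine (ContMDiffAt.comp y (g := (conjTriv eP eF ≫ₕ c).symm) (f := c) h1 h2).congr_of_eventuallyEq
    ?_
  filter_upwards [c.open_source.mem_nhds hcs] with w hw
  exact congrArg (conjTriv eP eF).symm (c.left_inv hw).symm

variable (EE EM EF EG EB F G φ) in
-- Locally the quotient map is `conjFwd`, smooth on E × G, followed by the inverse of the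
-- trivialization.
theorem ConjBundle.contMDiff_mk :
    ContMDiff (𝓘(ℝ, EE).prod 𝓘(ℝ, EG)) 𝓘(ℝ, EB × EF × EG) ∞ (ConjBundle.mk G EE EM F φ) := by
  intro x
  obtain ⟨eP, eF, hb⟩ := ConjBundle.exists_conjTriv (EE := EE) (EM := EM) (EF := EF) (EG := EG)
    (EB := EB) (F := F) (φ := φ) (orbitProj G M (φ x.1))
  have hU : {x : E × G | orbitProj G M (φ x.1) ∈ conjBase eP eF} ∈ 𝓝 x :=
    ((isOpen_conjBase eP eF).preimage (hA.contMDiff_orbitProj.continuous.comp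
      (hA.contMDiff_phi.continuous.comp continuous_fst))).mem_nhds hb
  have h1 := (contMDiffOn_conjFwd eP eF x hb).contMDiffAt hU
  have ht : conjFwd eP eF x ∈ (conjTriv eP eF).target := ⟨hb, trivial⟩
  have h2 := (contMDiffOn_conjTriv_symm eP eF _ ht).contMDiffAt
    ((conjTriv eP eF).open_target.mem_nhds ht)
  refine (h2.comp x h1).congr_of_eventuallyEq ?_
  filter_upwards [hU] with y hy
  exact (mk_conjBwd_conjFwd eP eF hy).symm

variable (EE EM EF EG EB F G φ) in
theorem ConjBundle.contMDiff_proj :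
    ContMDiff 𝓘(ℝ, EB × EF × EG) 𝓘(ℝ, EB) ∞ (ConjBundle.proj EE EM EF EG EB F G φ) := by
  intro v
  obtain ⟨eP, eF, hb⟩ := ConjBundle.exists_conjTriv (EE := EE) (EM := EM) (EF := EF) (EG := EG)
    (EB := EB) (F := F) (φ := φ) (ConjBundle.proj EE EM EF EG EB F G φ v)
  have hv : v ∈ (conjTriv eP eF).source := hb
  have hU := (conjTriv eP eF).open_source.mem_nhds hv
  refine (contMDiffAt_fst.comp v ((contMDiffOn_conjTriv eP eF v hv).contMDiffAt
    hU)).congr_of_eventuallyEq ?_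
  filter_upwards with w
  exact congrArg (ConjBundle.proj EE EM EF EG EB F G φ) (Quotient.out_eq w).symm

/-- The quotient map `E × G → (E × G)/G` has smooth local sections. -/
theorem ConjBundle.exists_section (v : ConjBundle G EE EM F φ) :
    ∃ τ : ConjBundle G EE EM F φ → E × G,
      ContMDiffAt 𝓘(ℝ, EB × EF × EG) (𝓘(ℝ, EE).prod 𝓘(ℝ, EG)) ∞ τ v ∧
      ∀ᶠ w in 𝓝 v, ConjBundle.mk G EE EM F φ (τ w) = w := by
  obtain ⟨eP, eF, hb⟩ := ConjBundle.exists_conjTriv (EE := EE) (EM := EM) (EF := EF) (EG := EG)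
    (EB := EB) (F := F) (φ := φ) (ConjBundle.proj EE EM EF EG EB F G φ v)
  have hv : v ∈ (conjTriv eP eF).source := hb
  have hU := (conjTriv eP eF).open_source.mem_nhds hv
  have ht := (conjTriv eP eF).map_source hv
  -- Each orbit over `conjBase` has one representative lying over the section of `eP`; `conjBwd`
  -- selects it.
  refine ⟨fun w => conjBwd eP eF (conjTriv eP eF w), ?_, ?_⟩
  · exact ((contMDiffOn_conjBwd eP eF _ ht).contMDiffAt
      ((conjTriv eP eF).open_target.mem_nhds ht)).comp v
      ((contMDiffOn_conjTriv eP eF v hv).contMDiffAt hU)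
  · filter_upwards [hU] with w hw
    exact (conjTriv eP eF).left_inv hw

end ConjBundleSmooth

/-! ### Discrete connections -/

section Connection

variable {EE EM EF EG EB : Type*}
  [NormedAddCommGroup EE] [NormedSpace ℝ EE] [NormedAddCommGroup EM] [NormedSpace ℝ EM]
  [NormedAddCommGroup EF] [NormedSpace ℝ EF] [NormedAddCommGroup EG] [NormedSpace ℝ EG]
  [NormedAddCommGroup EB] [NormedSpace ℝ EB]
  {E M F G : Type*} [TopologicalSpace E] [ChartedSpace EE E] [TopologicalSpace M]
  [ChartedSpace EM M] [TopologicalSpace F] [ChartedSpace EF F]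
  [TopologicalSpace G] [ChartedSpace EG G] [Group G]
  [MulAction G E] [MulAction G M] [MulAction Gᵐᵒᵖ F]
  [ChartedSpace EB (MulAction.orbitRel.Quotient G M)]
  {φ : E → M}

/-- The inverse fiber coordinates carry both points to the same section point. This expresses the
group element between two points of an orbit through trivialization coordinates, hence smoothly. -/
theorem PrincipalTriv.smul_of_orbitProj_eq [LieGroup 𝓘(ℝ, EG) ∞ G]
    (eP : PrincipalTriv EM EG EB M G) {a b : M}
    (ha : orbitProj G M a ∈ eP.baseSet) (hab : orbitProj G M a = orbitProj G M b) :
    ((eP.toOpenPartialHomeomorph a).2 * (eP.toOpenPartialHomeomorph b).2⁻¹) • b = a := by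
  rw [mul_smul, eP.inv_smul_eq_sect (hab ▸ ha), ← hab, ← eP.inv_smul_eq_sect ha, smul_inv_smul]

theorem smul_left_injective_of_free (hf : ∀ (g : G) (m : M), g • m = m → g = 1) {g h : G} {m : M}
    (hgh : g • m = h • m) : g = h := by
  have h1 := hf (h⁻¹ * g) m (by rw [mul_smul, hgh, inv_smul_smul])
  exact (inv_mul_eq_one.1 h1).symm

namespace DiscreteConnection

variable (A : DiscreteConnection EM EG EB M G)

theorem form_mem {q₀ q₁ : M} (h : (q₀, q₁) ∈ A.domain) : (q₀, (A.form q₀ q₁)⁻¹ • q₁) ∈ A.Hor := by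
  have h' : ∃ g : G, (q₀, g⁻¹ • q₁) ∈ A.Hor := by
    obtain ⟨q, g, hq, hg⟩ := h
    simp only at hq hg
    exact ⟨g, by rw [hg, inv_smul_smul]; exact hq⟩
  rw [form, dif_pos h']
  exact h'.choose_spec

theorem mem_domain {q₀ q₁ : M} {g : G} (h : (q₀, g⁻¹ • q₁) ∈ A.Hor) : (q₀, q₁) ∈ A.domain :=
  ⟨g⁻¹ • q₁, g, h, by simp⟩

/-- Two horizontal points with the same first entry and second entries in one orbit coincide by
injectivity of id × π on `Hor`; freeness then identifies the group elements. -/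
theorem form_eq (hf : ∀ (g : G) (m : M), g • m = m → g = 1) {q₀ q₁ : M} {g : G}
    (h : (q₀, g⁻¹ • q₁) ∈ A.Hor) : A.form q₀ q₁ = g := by
  have h1 := A.injective (A.form_mem (A.mem_domain h)) h (by simp [orbitProj_smul])
  exact inv_injective (smul_left_injective_of_free hf (congrArg Prod.snd h1))

theorem smul_mem_Hor {q₀ q₁ : M} (g : G) (h : (q₀, (A.form q₀ q₁)⁻¹ • q₁) ∈ A.Hor) :
    (g • q₀, (g * A.form q₀ q₁ * g⁻¹)⁻¹ • g • q₁) ∈ A.Hor := by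
  have h1 := A.invariant g _ h
  simpa [smul_smul, mul_assoc] using h1

theorem smul_mem_domain {q₀ q₁ : M} (g : G) (h : (q₀, q₁) ∈ A.domain) :
    (g • q₀, g • q₁) ∈ A.domain :=
  A.mem_domain (A.smul_mem_Hor g (A.form_mem h))

theorem form_smul (hf : ∀ (g : G) (m : M), g • m = m → g = 1) {q₀ q₁ : M} (g : G)
    (h : (q₀, q₁) ∈ A.domain) : A.form (g • q₀) (g • q₁) = g * A.form q₀ q₁ * g⁻¹ :=
  A.form_eq hf (A.smul_mem_Hor g (A.form_mem h))

/-- Locally, the points of `M × M/G` lift smoothly to `Hor`. -/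
theorem exists_horLift {q₀ q₁ : M} (h : (q₀, q₁) ∈ A.domain) :
    ∃ ρ : M × MulAction.orbitRel.Quotient G M → M,
      ContMDiffAt (𝓘(ℝ, EM).prod 𝓘(ℝ, EB)) 𝓘(ℝ, EM) ∞ ρ (q₀, orbitProj G M q₁) ∧
      ∀ᶠ z in 𝓝 (q₀, orbitProj G M q₁), (z.1, ρ z) ∈ A.Hor ∧ orbitProj G M (ρ z) = z.2 := by
  obtain ⟨W, V, s, -, hW, hV, hmV, hsW, hinv, hs⟩ := A.localDiffeo _ (A.form_mem h)
  have hmem : (q₀, orbitProj G M q₁) ∈ V := by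
    have := hmV ⟨A.form_mem h, hW⟩
    simpa [orbitProj_smul] using this
  refine ⟨fun z => (s z).2, ?_, ?_⟩
  · exact contMDiffAt_snd.comp _ ((hs _ hmem).contMDiffAt (hV.mem_nhds hmem))
  · filter_upwards [hV.mem_nhds hmem] with z hz
    have h1 := hinv.2 hz
    have h2 : (s z).1 = z.1 := congrArg Prod.fst h1
    exact ⟨h2 ▸ (hsW hz).1, congrArg Prod.snd h1⟩

variable [LieGroup 𝓘(ℝ, EG) ∞ G]

/-- The domain of a discrete connection is open, and its form is smooth there. -/
theorem contMDiffAt_form (hA : ActsOnFiberBundle EE EM EF EG EB F G φ) {q₀ q₁ : M}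
    (h : (q₀, q₁) ∈ A.domain) :
    (∀ᶠ p in 𝓝 (q₀, q₁), p ∈ A.domain) ∧
    ContMDiffAt (𝓘(ℝ, EM).prod 𝓘(ℝ, EM)) 𝓘(ℝ, EG) ∞ (fun p : M × M => A.form p.1 p.2)
      (q₀, q₁) := by
  obtain ⟨ρ, hρ, hev⟩ := A.exists_horLift h
  obtain ⟨eP, hP⟩ := hA.principal (orbitProj G M q₁)
  have hπ := hA.contMDiff_orbitProj
  have hk : ContMDiffAt (𝓘(ℝ, EM).prod 𝓘(ℝ, EM)) (𝓘(ℝ, EM).prod 𝓘(ℝ, EB)) ∞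
      (fun p : M × M => (p.1, orbitProj G M p.2)) (q₀, q₁) :=
    contMDiffAt_fst.prodMk (hπ.contMDiffAt.comp _ contMDiffAt_snd)
  have hρ' : ContMDiffAt (𝓘(ℝ, EM).prod 𝓘(ℝ, EM)) 𝓘(ℝ, EM) ∞
      (fun p : M × M => ρ (p.1, orbitProj G M p.2)) (q₀, q₁) :=
    ContMDiffAt.comp (q₀, q₁) (g := ρ) (f := fun p : M × M => (p.1, orbitProj G M p.2)) hρ hk
  have hev' := hk.continuousAt.eventually hev
  have hbase : ∀ᶠ p in 𝓝 (q₀, q₁), orbitProj G M p.2 ∈ eP.baseSet :=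
    (hπ.continuous.comp continuous_snd).continuousAt.eventually (eP.open_baseSet.mem_nhds hP)
  have heP : ∀ m, orbitProj G M m ∈ eP.baseSet → ContMDiffAt 𝓘(ℝ, EM) 𝓘(ℝ, EG) ∞
      (fun m => (eP.toOpenPartialHomeomorph m).2) m := fun m hm =>
    contMDiffAt_snd.comp m ((eP.smooth_toFun m (eP.mem_source.2 hm)).contMDiffAt
      (eP.toOpenPartialHomeomorph.open_source.mem_nhds (eP.mem_source.2 hm)))
  -- The horizontal lift of (p.1, π(p.2)) lies in the orbit of p.2, and the displayed quotient of
  -- fiber coordinates moves it to p.2. This yields both the openness of the domain and a smooth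
  -- formula for the form.
  have key : ∀ᶠ p in 𝓝 (q₀, q₁), (p.1, ((eP.toOpenPartialHomeomorph p.2).2 *
      (eP.toOpenPartialHomeomorph (ρ (p.1, orbitProj G M p.2))).2⁻¹)⁻¹ • p.2) ∈ A.Hor := by
    filter_upwards [hev', hbase] with p hp hb
    have h1 := eP.smul_of_orbitProj_eq hb hp.2.symm
    have h2 := inv_smul_eq_iff.2 h1.symm
    rw [h2]
    exact hp.1
  refine ⟨key.mono fun p hp => A.mem_domain hp, ?_⟩
  refine ContMDiffAt.congr_of_eventuallyEq (f := fun p : M × M =>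
    (eP.toOpenPartialHomeomorph p.2).2 *
      (eP.toOpenPartialHomeomorph (ρ (p.1, orbitProj G M p.2))).2⁻¹) ?_
    (key.mono fun p hp => A.form_eq hA.free_base hp)
  have h0 : orbitProj G M (ρ (q₀, orbitProj G M q₁)) = orbitProj G M q₁ := hev.self_of_nhds.2
  exact ((heP q₁ hP).comp (q₀, q₁) contMDiffAt_snd).mul
    ((((heP (ρ (q₀, orbitProj G M q₁)) (by rw [h0]; exact hP)).comp (q₀, q₁) hρ')).inv)

end DiscreteConnection

end Connection

/-! ### The map `Υ` -/

section Upsilon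

variable {EE EM EF EG EB : Type*}
  [NormedAddCommGroup EE] [NormedSpace ℝ EE] [NormedAddCommGroup EM] [NormedSpace ℝ EM]
  [NormedAddCommGroup EF] [NormedSpace ℝ EF] [NormedAddCommGroup EG] [NormedSpace ℝ EG]
  [NormedAddCommGroup EB] [NormedSpace ℝ EB]
  {E M F G : Type*} [TopologicalSpace E] [ChartedSpace EE E] [TopologicalSpace M]
  [ChartedSpace EM M] [TopologicalSpace F] [ChartedSpace EF F]
  [TopologicalSpace G] [ChartedSpace EG G] [Group G]
  [MulAction G E] [MulAction G M] [MulAction Gᵐᵒᵖ F]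
  [ChartedSpace EB (MulAction.orbitRel.Quotient G M)]
  {φ : E → M} [LieGroup 𝓘(ℝ, EG) ∞ G]
  (A : DiscreteConnection EM EG EB M G)

namespace DiscreteConnection

theorem smul_mem_upsilonDomain (hA : ActsOnFiberBundle EE EM EF EG EB F G φ)
    (g : G) {x : E × M} (hx : x ∈ A.upsilonDomain φ) :
    g • x ∈ A.upsilonDomain φ := by
  change (φ (g • x.1), g • x.2) ∈ A.domain
  rw [hA.equivariant]
  exact A.smul_mem_domain g hx

theorem upsilon_smul (hA : ActsOnFiberBundle EE EM EF EG EB F G φ) (g : G) {x : E × M}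
    (hx : x ∈ A.upsilonDomain φ) : A.upsilon EE F φ (g • x) = A.upsilon EE F φ x := by
  have h : A.form (φ (g • x.1)) (g • x.2) = g * A.form (φ x.1) x.2 * g⁻¹ := by
    rw [hA.equivariant, A.form_smul hA.free_base g hx]
  refine Prod.ext ?_ (orbitProj_smul g x.2)
  exact ((ConjBundle.mk_eq_mk G EE EM F φ).2 ⟨g, rfl, h.symm⟩).symm

/-- Equality of the classes gives g with ε' = gε and conjugate values of the form. The translate by
g of the horizontal point of x and the horizontal point of x' then agree after id × π, hence agree;
cancelling the common value of the form leaves m' = gm. -/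
theorem exists_smul_of_upsilon_eq (hA : ActsOnFiberBundle EE EM EF EG EB F G φ)
    {x x' : E × M} (hx : x ∈ A.upsilonDomain φ) (hx' : x' ∈ A.upsilonDomain φ)
    (h : A.upsilon EE F φ x = A.upsilon EE F φ x') :
    ∃ g : G, x' = g • x := by
  obtain ⟨g, h1, h2⟩ := (ConjBundle.mk_eq_mk G EE EM F φ).1 (congrArg Prod.fst h)
  have h3 : orbitProj G M x.2 = orbitProj G M x'.2 := congrArg Prod.snd h
  simp only at h1 h2
  have h4 := A.smul_mem_Hor g (A.form_mem hx)
  have h5 := A.form_mem hx'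
  rw [h2, ← hA.equivariant, h1] at h4
  have h6 := congrArg Prod.snd (A.injective h4 h5 (by simp [orbitProj_smul, h3]))
  exact ⟨g, Prod.ext h1.symm (smul_left_cancel _ h6).symm⟩

theorem contMDiffAt_form_phi (hA : ActsOnFiberBundle EE EM EF EG EB F G φ)
    {x : E × M} (hx : x ∈ A.upsilonDomain φ) :
    (∀ᶠ z in 𝓝 x, z ∈ A.upsilonDomain φ) ∧
    ContMDiffAt (𝓘(ℝ, EE).prod 𝓘(ℝ, EM)) 𝓘(ℝ, EG) ∞ (fun z : E × M => A.form (φ z.1) z.2) x := by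
  obtain ⟨h1, h2⟩ := A.contMDiffAt_form hA hx
  have hk : ContMDiffAt (𝓘(ℝ, EE).prod 𝓘(ℝ, EM)) (𝓘(ℝ, EM).prod 𝓘(ℝ, EM)) ∞
      (fun z : E × M => (φ z.1, z.2)) x :=
    (hA.contMDiff_phi.contMDiffAt.comp x contMDiffAt_fst).prodMk contMDiffAt_snd
  exact ⟨hk.continuousAt.eventually h1,
    ContMDiffAt.comp x (g := fun p : M × M => A.form p.1 p.2)
      (f := fun z : E × M => (φ z.1, z.2)) h2 hk⟩

variable [hA : ActsOnFiberBundle EE EM EF EG EB F G φ] [IsManifold 𝓘(ℝ, EF) ∞ F]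
  [IsManifold 𝓘(ℝ, EB) ∞ (MulAction.orbitRel.Quotient G M)]

theorem contMDiffAt_upsilon {x : E × M} (hx : x ∈ A.upsilonDomain φ) :
    ContMDiffAt (𝓘(ℝ, EE).prod 𝓘(ℝ, EM)) (𝓘(ℝ, EB × EF × EG).prod 𝓘(ℝ, EB)) ∞
      (A.upsilon EE F φ) x := by
  refine ContMDiffAt.prodMk ?_ (hA.contMDiff_orbitProj.contMDiffAt.comp x contMDiffAt_snd)
  exact (ConjBundle.contMDiff_mk EE EM EF EG EB F G φ).contMDiffAt.comp x
    (contMDiffAt_fst.prodMk (A.contMDiffAt_form_phi hA hx).2)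

/-- `Υ` has smooth local sections. -/
theorem exists_section_upsilon {x : E × M} (hx : x ∈ A.upsilonDomain φ) :
    ∃ σ : ConjBundle G EE EM F φ × MulAction.orbitRel.Quotient G M → E × M,
      ContMDiffAt (𝓘(ℝ, EB × EF × EG).prod 𝓘(ℝ, EB)) (𝓘(ℝ, EE).prod 𝓘(ℝ, EM)) ∞ σ
        (A.upsilon EE F φ x) ∧
      ∀ᶠ w in 𝓝 (A.upsilon EE F φ x), σ w ∈ A.upsilonDomain φ ∧ A.upsilon EE F φ (σ w) = w := by
  set w₀ := A.upsilon EE F φ x with hw₀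
  obtain ⟨τ, hτ, hτe⟩ := ConjBundle.exists_section (EB := EB) (EF := EF) (EG := EG) w₀.1
  -- The representative chosen by `τ` may differ from that of x by some g; translating m by the same
  -- g stays in the domain, so a horizontal lift is available there.
  obtain ⟨g, hg1, -⟩ := (ConjBundle.mk_eq_mk G EE EM F φ).1
    (show ConjBundle.mk G EE EM F φ (x.1, A.form (φ x.1) x.2) = _ from hτe.self_of_nhds.symm)
  have hdom : (φ (τ w₀.1).1, g • x.2) ∈ A.domain := by
    have := A.smul_mem_upsilonDomain hA g hx
    rw [← hg1]
    exact this
  obtain ⟨ρ, hρ, hρe⟩ := A.exists_horLift hdom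
  rw [orbitProj_smul] at hρ hρe
  have hτ' : ContMDiffAt (𝓘(ℝ, EB × EF × EG).prod 𝓘(ℝ, EB)) (𝓘(ℝ, EE).prod 𝓘(ℝ, EG)) ∞
      (fun w : ConjBundle G EE EM F φ × MulAction.orbitRel.Quotient G M => τ w.1) w₀ :=
    ContMDiffAt.comp w₀ (g := τ) (f := Prod.fst) hτ contMDiffAt_fst
  have hk : ContMDiffAt (𝓘(ℝ, EB × EF × EG).prod 𝓘(ℝ, EB)) (𝓘(ℝ, EM).prod 𝓘(ℝ, EB)) ∞
      (fun w : ConjBundle G EE EM F φ × MulAction.orbitRel.Quotient G M => (φ (τ w.1).1, w.2))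
      w₀ :=
    (hA.contMDiff_phi.contMDiffAt.comp w₀ (contMDiffAt_fst.comp w₀ hτ')).prodMk contMDiffAt_snd
  have hρ' : ContMDiffAt (𝓘(ℝ, EB × EF × EG).prod 𝓘(ℝ, EB)) 𝓘(ℝ, EM) ∞
      (fun w : ConjBundle G EE EM F φ × MulAction.orbitRel.Quotient G M =>
        ρ (φ (τ w.1).1, w.2)) w₀ :=
    ContMDiffAt.comp w₀ (g := ρ) (f := fun w : ConjBundle G EE EM F φ ×
      MulAction.orbitRel.Quotient G M => (φ (τ w.1).1, w.2)) hρ hk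
  -- With (ε, h) representing w.1, translating by h the horizontal partner of φ(ε) over w.2 gives
  -- the point m in the orbit w.2 with A_d(φ(ε), m) = h.
  refine ⟨fun w => ((τ w.1).1, (τ w.1).2 • ρ (φ (τ w.1).1, w.2)), ?_, ?_⟩
  · exact (contMDiffAt_fst.comp w₀ hτ').prodMk (hA.smooth_smul_base.contMDiffAt.comp w₀
      ((contMDiffAt_snd.comp w₀ hτ').prodMk hρ'))
  · have h1 : ∀ᶠ w in 𝓝 w₀, ConjBundle.mk G EE EM F φ (τ w.1) = w.1 :=
      continuousAt_fst.eventually hτe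
    have h2 : ∀ᶠ w in 𝓝 w₀, (φ (τ w.1).1, ρ (φ (τ w.1).1, w.2)) ∈ A.Hor ∧
        orbitProj G M (ρ (φ (τ w.1).1, w.2)) = w.2 := hk.continuousAt.eventually hρe
    filter_upwards [h1, h2] with w hw hw'
    have h3 : (φ (τ w.1).1, (τ w.1).2⁻¹ • (τ w.1).2 • ρ (φ (τ w.1).1, w.2)) ∈ A.Hor := by
      rw [inv_smul_smul]; exact hw'.1
    refine ⟨A.mem_domain h3, Prod.ext ?_ ?_⟩
    · change ConjBundle.mk G EE EM F φ ((τ w.1).1, A.form _ _) = w.1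
      rw [A.form_eq hA.free_base h3]
      exact hw
    · exact (orbitProj_smul _ _).trans hw'.2

/-- Along the fibers of `E × M → M`, the map `Υ` has a smooth local left inverse. -/
theorem exists_leftInverse_upsilon {x : E × M} (hx : x ∈ A.upsilonDomain φ) :
    ∃ H : ConjBundle G EE EM F φ × MulAction.orbitRel.Quotient G M → E,
      ContMDiffAt (𝓘(ℝ, EB × EF × EG).prod 𝓘(ℝ, EB)) 𝓘(ℝ, EE) ∞ H (A.upsilon EE F φ x) ∧
      ∀ᶠ ε in 𝓝 x.1, H (A.upsilon EE F φ (ε, x.2)) = ε := by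
  obtain ⟨σ, hσ, hσe⟩ := A.exists_section_upsilon (EE := EE) (EF := EF) (F := F) hx
  obtain ⟨eP, hP⟩ := hA.principal (orbitProj G M x.2)
  have hσ2 : orbitProj G M (σ (A.upsilon EE F φ x)).2 = orbitProj G M x.2 :=
    congrArg Prod.snd hσe.self_of_nhds.2
  have hs : (σ (A.upsilon EE F φ x)).2 ∈ eP.toOpenPartialHomeomorph.source :=
    eP.mem_source.2 (by rw [hσ2]; exact hP)
  have heP : ContMDiffAt 𝓘(ℝ, EM) 𝓘(ℝ, EG) ∞ (fun m => (eP.toOpenPartialHomeomorph m).2)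
      (σ (A.upsilon EE F φ x)).2 :=
    contMDiffAt_snd.comp _ ((eP.smooth_toFun _ hs).contMDiffAt
      (eP.toOpenPartialHomeomorph.open_source.mem_nhds hs))
  -- The section returns (ε, x.2) only up to some g. As x.2 is fixed and the action on M is free, g
  -- can be read off the second components and then applied to the first.
  refine ⟨fun w => ((eP.toOpenPartialHomeomorph x.2).2 *
    (eP.toOpenPartialHomeomorph (σ w).2).2⁻¹) • (σ w).1, ?_, ?_⟩
  · refine hA.smooth_smul_total.contMDiffAt.comp _ (ContMDiffAt.prodMk ?_ ?_)
    · refine contMDiffAt_const.mul (ContMDiffAt.inv ?_)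
      exact ContMDiffAt.comp _ (g := fun m => (eP.toOpenPartialHomeomorph m).2)
        (f := fun w => (σ w).2) heP (contMDiffAt_snd.comp _ hσ)
    · exact contMDiffAt_fst.comp _ hσ
  · have hi : ContinuousAt (fun ε : E => (ε, x.2)) x.1 := by fun_prop
    have h1 : ∀ᶠ ε in 𝓝 x.1, (ε, x.2) ∈ A.upsilonDomain φ :=
      hi.eventually (A.contMDiffAt_form_phi hA hx).1
    have h2 := ((A.contMDiffAt_upsilon (EE := EE) (EF := EF) (F := F)
      hx).continuousAt.comp_of_eq hi rfl).eventually hσe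
    filter_upwards [h1, h2] with ε hε hσε
    obtain ⟨g, hg⟩ := A.exists_smul_of_upsilon_eq hA hσε.1 hε hσε.2
    have hg1 : ε = g • _ := congrArg Prod.fst hg
    have hg2 : x.2 = g • _ := congrArg Prod.snd hg
    have h3 : orbitProj G M x.2 = orbitProj G M (σ (A.upsilon EE F φ (ε, x.2))).2 :=
      (congrArg Prod.snd hσε.2).symm
    have h4 := eP.smul_of_orbitProj_eq hP h3
    have h5 := smul_left_injective_of_free hA.free_base (h4.trans hg2)
    exact (congrArg (· • (σ (A.upsilon EE F φ (ε, x.2))).1) h5).trans hg1.symm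

end DiscreteConnection

end Upsilon

/-! ### Trajectories and equations of motion -/

section PiManifold

variable {ι V H X : Type*} [Fintype ι] [NormedAddCommGroup V] [NormedSpace ℝ V]
  [TopologicalSpace H] (I : ModelWithCorners ℝ V H) [TopologicalSpace X] [ChartedSpace H X]

/-- In product charts the projection is itself a linear coordinate projection. It allows the action
to be differentiated term by term. -/
theorem hasMFDerivAt_pi_apply (i : ι) (x : ι → X) :
    HasMFDerivAt (ModelWithCorners.pi fun _ : ι => I) I (fun z : ι → X => z i) x
      (ContinuousLinearMap.proj (R := ℝ) (φ := fun _ : ι => V) i) := by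
  refine ⟨(continuous_apply i).continuousAt, ?_⟩
  have h : HasFDerivWithinAt (fun z : ι → V => z i)
      (ContinuousLinearMap.proj (R := ℝ) (φ := fun _ : ι => V) i)
      (range (ModelWithCorners.pi fun _ : ι => I))
      (extChartAt (ModelWithCorners.pi fun _ : ι => I) x x) :=
    (hasFDerivAt_apply (𝕜 := ℝ) i _).hasFDerivWithinAt
  refine h.congr_of_eventuallyEq ?_ ?_
  · filter_upwards [extChartAt_target_mem_nhdsWithin (I := ModelWithCorners.pi fun _ : ι => I) x]
      with z hz
    have hz' : z i ∈ (extChartAt I (x i)).target := by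
      rw [extChartAt_target] at hz ⊢
      obtain ⟨h1, h2⟩ := hz
      refine ⟨h1 i (mem_univ i), ?_⟩
      obtain ⟨y, rfl⟩ := h2
      exact ⟨y i, rfl⟩
    exact (extChartAt I (x i)).right_inv hz'
  · exact congrArg (extChartAt I (x i))
      (congrFun (extChartAt_to_inv (I := ModelWithCorners.pi fun _ : ι => I) x) i)

end PiManifold

namespace DLDPSData

variable {EE EM : Type*}
  [NormedAddCommGroup EE] [NormedSpace ℝ EE] [NormedAddCommGroup EM] [NormedSpace ℝ EM]
  {E M : Type*} [TopologicalSpace E] [ChartedSpace EE E] [TopologicalSpace M] [ChartedSpace EM M]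
  {φ : E → M} (S : DLDPSData EE EM φ)

/-- The differential of the discrete Lagrangian, in the coordinates of the tangent space. -/
def dL (x : E × M) : EE × EM →L[ℝ] ℝ := mfderiv (𝓘(ℝ, EE).prod 𝓘(ℝ, EM)) 𝓘(ℝ, ℝ) S.L x

/-- The differential of `φ`, in the coordinates of the tangent spaces. -/
def dphi (_S : DLDPSData EE EM φ) (ε : E) : EE →L[ℝ] EM := mfderiv 𝓘(ℝ, EE) 𝓘(ℝ, EM) φ ε

/-- The chaining map, in the coordinates of the tangent spaces. -/
def chain (x y : E × M) (u : EE) : EE := S.P x y u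

/-- The variational constraints, in the coordinates of the tangent space. -/
def fiber (x : E × M) : Submodule ℝ EE := S.D x

/-- The two derivatives at x are merged into one, since dΥ transports the pair (𝒫u, dφ u) as a whole
and not its components separately. -/
theorem nu_eq (x y : E × M) (u : EE) :
    S.nu x y u = S.dL y (u, 0) + S.dL x (S.chain x y u, S.dphi y.1 u) := by
  have h : S.dL x (S.chain x y u, S.dphi y.1 u) =
      S.dL x (0, S.dphi y.1 u) + S.dL x (S.chain x y u, 0) := by
    rw [← map_add, Prod.mk_add_mk, zero_add, add_zero]
  rw [h, ← add_assoc]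
  rfl

theorem nu_zero {x y : E × M} (h : S.P x y 0 = 0) : S.nu x y 0 = 0 := by
  refine (S.nu_eq x y 0).trans ?_
  have h1 : S.chain x y 0 = 0 := h
  have h2 : S.dL y ((0 : EE), (0 : EM)) + S.dL x (S.chain x y 0, S.dphi y.1 0) = 0 := by
    rw [h1, map_zero (S.dphi y.1), ← Prod.zero_eq_mk, map_zero, map_zero, add_zero]
  exact h2

theorem mfderiv_action {N : ℕ} {x : Fin N → E × M}
    (hL : ∀ k, MDifferentiableAt (𝓘(ℝ, EE).prod 𝓘(ℝ, EM)) 𝓘(ℝ, ℝ) S.L (x k))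
    (δ : PathTangent (EE := EE) (EM := EM) x) :
    mfderiv (ModelWithCorners.pi fun _ : Fin N => 𝓘(ℝ, EE).prod 𝓘(ℝ, EM)) 𝓘(ℝ, ℝ)
      (S.action N) x δ = ∑ k, S.dL (x k) ((δ : Fin N → EE × EM) k) := by
  have h : ∀ k ∈ Finset.univ, HasMFDerivAt
      (ModelWithCorners.pi fun _ : Fin N => 𝓘(ℝ, EE).prod 𝓘(ℝ, EM)) 𝓘(ℝ, ℝ)
      (fun z : Fin N → E × M => S.L (z k)) x
      ((S.dL (x k)).comp (ContinuousLinearMap.proj (R := ℝ) (φ := fun _ : Fin N => EE × EM) k)) :=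
    fun k _ =>
    (hL k).hasMFDerivAt.comp x (hasMFDerivAt_pi_apply (𝓘(ℝ, EE).prod 𝓘(ℝ, EM)) k x)
  have hs := HasMFDerivAt.sum h
  have he : (∑ k, fun z : Fin N → E × M => S.L (z k)) = S.action N := by
    ext z
    simp [action]
  rw [he] at hs
  have happ : ∀ (T : Fin N → (Fin N → EE × EM) →L[ℝ] ℝ) (v : Fin N → EE × EM),
      (∑ k, T k) v = ∑ k, T k v := fun T v => by simp
  exact (congrArg (fun T : (Fin N → EE × EM) →L[ℝ] ℝ => T δ) hs.mfderiv).trans (happ _ δ)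

/-- The differential of the action along a nonholonomic variation is a sum of values of the
section of motion. -/
theorem sum_dL_eq_sum_nu {n : ℕ} {x : Fin (n + 1) → E × M}
    (hPv : ∀ (k : ℕ) (hk : k + 1 < n + 1), ∀ u ∈ S.D (x ⟨k + 1, hk⟩),
      S.dphi (x ⟨k, Nat.lt_of_succ_lt hk⟩).1
        (S.P (x ⟨k, Nat.lt_of_succ_lt hk⟩) (x ⟨k + 1, hk⟩) u) = 0)
    (δ : Fin (n + 1) → EE × EM) (t : Fin (n + 1) → EE)
    (ht : ∀ k : Fin (n + 1), 1 ≤ (k : ℕ) → (t k : TangentSpace 𝓘(ℝ, EE) (x k).1) ∈ S.D (x k))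
    (hvar : ∀ j : Fin n, (δ j.castSucc).2 = S.dphi (x j.succ).1 (δ j.succ).1)
    (hlast : (δ (Fin.last n)).2 = 0)
    (hδ : ∀ k : Fin (n + 1), (δ k).1 = (if 1 ≤ (k : ℕ) then t k else 0) +
      (if hk : (k : ℕ) + 1 < n + 1 then S.chain (x k) (x ⟨k + 1, hk⟩) (t ⟨k + 1, hk⟩) else 0)) :
    ∑ k, S.dL (x k) (δ k) = ∑ j : Fin n, S.nu (x j.castSucc) (x j.succ) (t j.succ) := by
  -- `b` is the chained part of δε; it is vertical and vanishes at the last index.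
  set b : Fin (n + 1) → EE := fun k => if hk : (k : ℕ) + 1 < n + 1 then
    S.chain (x k) (x ⟨k + 1, hk⟩) (t ⟨k + 1, hk⟩) else 0 with hb
  have hb1 : ∀ j : Fin n, b j.castSucc = S.chain (x j.castSucc) (x j.succ) (t j.succ) := by
    intro j
    have hk : (j.castSucc : ℕ) + 1 < n + 1 := by simp
    simp only [hb]
    exact dif_pos hk
  have hb2 : b (Fin.last n) = 0 := by simp [hb]
  have hb3 : ∀ k, S.dphi (x k).1 (b k) = 0 := by
    intro k
    refine Fin.lastCases ?_ (fun j => ?_) k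
    · rw [hb2, map_zero]
    · rw [hb1]
      exact hPv j (by simp) _ (ht j.succ (by simp))
  have hsplit : ∀ k, S.dL (x k) (δ k) =
      S.dL (x k) (if 1 ≤ (k : ℕ) then t k else 0, 0) + S.dL (x k) (b k, (δ k).2) := by
    intro k
    rw [← map_add]
    congr 1
    exact Prod.ext (hδ k) (by simp)
  -- The summation by parts: the `t` part has no term at index 0 and the rest has none at index n.
  -- Dropping these lets the `t` term at j + 1 be paired with the chained term at j.
  rw [Finset.sum_congr rfl fun k _ => hsplit k, Finset.sum_add_distrib,
    Fin.sum_univ_succ (fun k : Fin (n + 1) => S.dL (x k) (if 1 ≤ (k : ℕ) then t k else 0, 0)),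
    Fin.sum_univ_castSucc (fun k : Fin (n + 1) => S.dL (x k) (b k, (δ k).2)), hb2, hlast]
  have h0 : S.dL (x 0) (if 1 ≤ ((0 : Fin (n + 1)) : ℕ) then t 0 else 0, 0) = 0 := by
    rw [if_neg (by simp)]
    exact map_zero _
  have h1 : S.dL (x (Fin.last n)) (0, 0) = 0 := map_zero _
  rw [h0, h1, zero_add, add_zero, ← Finset.sum_add_distrib]
  refine Finset.sum_congr rfl fun j _ => ?_
  have h2 : S.dphi (x j.succ).1 (δ j.succ).1 = S.dphi (x j.succ).1 (t j.succ) := by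
    have h3 : (δ j.succ).1 = t j.succ + b j.succ := by
      rw [hδ, if_pos (by simp)]
    rw [h3, map_add, hb3, add_zero]
  rw [if_pos (by simp), hvar, h2, hb1]
  exact (S.nu_eq _ _ _).symm

/-- A discrete path is a trajectory if and only if it satisfies the equations of motion. -/
theorem isTrajectory_iff {N : ℕ} {x : Fin N → E × M} (hx : IsDiscretePath φ x)
    (hL : ∀ k, MDifferentiableAt (𝓘(ℝ, EE).prod 𝓘(ℝ, EM)) 𝓘(ℝ, ℝ) S.L (x k))
    (hP0 : ∀ (k : ℕ) (hk : k + 1 < N),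
      S.P (x ⟨k, Nat.lt_of_succ_lt hk⟩) (x ⟨k + 1, hk⟩) 0 = 0)
    (hPv : ∀ (k : ℕ) (hk : k + 1 < N), ∀ u ∈ S.D (x ⟨k + 1, hk⟩),
      mfderiv 𝓘(ℝ, EE) 𝓘(ℝ, EM) φ (x ⟨k, Nat.lt_of_succ_lt hk⟩).1
        (S.P (x ⟨k, Nat.lt_of_succ_lt hk⟩) (x ⟨k + 1, hk⟩) u) = 0) :
    S.IsTrajectory x ↔ S.SatisfiesEquations x := by
  obtain _ | n := N
  · refine ⟨fun h => ⟨h.2.1, fun k hk => absurd hk (by simp)⟩, fun h => ⟨hx, h.1, fun δ _ => ?_⟩⟩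
    rw [S.mfderiv_action hL, Fin.sum_univ_zero]
    rfl
  constructor
  · rintro ⟨-, hd, h⟩
    refine ⟨hd, fun k hk u hu => ?_⟩
    have hkn : k < n := by omega
    -- A generator supported at a single index isolates one value of the section of motion.
    let t : Fin (n + 1) → EE := Function.update 0 ⟨k + 1, hk⟩ u
    have ht : ∀ i : Fin (n + 1), (t i : TangentSpace 𝓘(ℝ, EE) (x i).1) ∈ S.D (x i) := by
      intro i
      by_cases hi : i = ⟨k + 1, hk⟩
      · subst hi
        have : t ⟨k + 1, hk⟩ = u := Function.update_self _ _ _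
        rw [this]
        exact hu
      · have : t i = 0 := Function.update_of_ne hi _ _
        rw [this]
        exact (S.D (x i)).zero_mem
    let a : Fin (n + 1) → EE := fun i => (if 1 ≤ (i : ℕ) then t i else 0) +
      (if hi : (i : ℕ) + 1 < n + 1 then S.chain (x i) (x ⟨i + 1, hi⟩) (t ⟨i + 1, hi⟩) else 0)
    -- The components δm are forced by dφ; the default 0 at the last index is the fixed endpoint.
    let δ : Fin (n + 1) → EE × EM := fun i =>
      (a i, if hi : (i : ℕ) + 1 < n + 1 then S.dphi (x ⟨i + 1, hi⟩).1 (a ⟨i + 1, hi⟩) else 0)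
    have hv : ∀ (i : ℕ) (hi : i + 1 < n + 1), (δ ⟨i, Nat.lt_of_succ_lt hi⟩).2 =
        S.dphi (x ⟨i + 1, hi⟩).1 (δ ⟨i + 1, hi⟩).1 := fun i hi => dif_pos hi
    have hl : ∀ i : Fin (n + 1), (i : ℕ) + 1 = n + 1 → (δ i).2 = 0 :=
      fun i hi => dif_neg (by omega)
    have h1 := h δ ⟨hv, hl, t, fun i _ => ht i, fun i => rfl⟩
    replace h1 := (S.mfderiv_action hL δ).symm.trans h1
    rw [S.sum_dL_eq_sum_nu hPv δ t (fun i _ => ht i)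
      (fun j => hv j (by simp)) (hl _ (by simp)) (fun i => rfl)] at h1
    rw [Finset.sum_eq_single (⟨k, hkn⟩ : Fin n)] at h1
    · have h2 : t (Fin.succ ⟨k, hkn⟩) = u := Function.update_self _ _ _
      rw [h2] at h1
      exact h1
    · intro j _ hj
      have h2 : t j.succ = 0 := Function.update_of_ne
        (fun he => hj (Fin.ext (by have := congrArg Fin.val he; simpa using this))) _ _
      rw [h2]
      exact S.nu_zero (hP0 j (by simp))
    · simp
  · rintro ⟨hd, h⟩
    refine ⟨hx, hd, ?_⟩
    rintro δ ⟨hv, hl, t, ht, hδ⟩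
    rw [S.mfderiv_action hL, S.sum_dL_eq_sum_nu hPv δ t ht (fun j => hv j (by simp))
      (hl _ (by simp)) hδ]
    exact Finset.sum_eq_zero fun j _ => h j (by simp) _ (ht j.succ (by simp))

end DLDPSData

/-! ### The differential of `Υ` and the reduced system -/

section Differentials

variable {EE EM EF EG EB : Type*}
  [NormedAddCommGroup EE] [NormedSpace ℝ EE] [NormedAddCommGroup EM] [NormedSpace ℝ EM]
  [NormedAddCommGroup EF] [NormedSpace ℝ EF] [NormedAddCommGroup EG] [NormedSpace ℝ EG]
  [NormedAddCommGroup EB] [NormedSpace ℝ EB]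
  {E M F G : Type*} [TopologicalSpace E] [ChartedSpace EE E] [TopologicalSpace M]
  [ChartedSpace EM M] [TopologicalSpace F] [ChartedSpace EF F]
  [TopologicalSpace G] [ChartedSpace EG G] [Group G]
  [MulAction G E] [MulAction G M] [MulAction Gᵐᵒᵖ F]
  [ChartedSpace EB (MulAction.orbitRel.Quotient G M)]
  {φ : E → M} [LieGroup 𝓘(ℝ, EG) ∞ G]

theorem ActsOnFiberBundle.mdifferentiable_smul_total
    (hA : ActsOnFiberBundle EE EM EF EG EB F G φ) (g : G) :
    MDifferentiable 𝓘(ℝ, EE) 𝓘(ℝ, EE) (fun ε : E => g • ε) :=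
  (hA.smooth_smul_total.comp (contMDiff_const.prodMk contMDiff_id)).mdifferentiable (by simp)

theorem ActsOnFiberBundle.mdifferentiable_smul_base
    (hA : ActsOnFiberBundle EE EM EF EG EB F G φ) (g : G) :
    MDifferentiable 𝓘(ℝ, EM) 𝓘(ℝ, EM) (fun m : M => g • m) :=
  (hA.smooth_smul_base.comp (contMDiff_const.prodMk contMDiff_id)).mdifferentiable (by simp)

variable (EE) in
/-- The differential of the action of `g` on a manifold, in the coordinates of the tangent
spaces. -/
def dsmul (g : G) (ε : E) : EE →L[ℝ] EE := mfderiv 𝓘(ℝ, EE) 𝓘(ℝ, EE) (fun ε : E => g • ε) ε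

variable (EM EB G) in
/-- The differential of `π^{M,G}`, in the coordinates of the tangent spaces. -/
def dorbitProj (m : M) : EM →L[ℝ] EB := mfderiv 𝓘(ℝ, EM) 𝓘(ℝ, EB) (orbitProj G M) m

theorem ActsOnFiberBundle.dphi_dsmul (hA : ActsOnFiberBundle EE EM EF EG EB F G φ)
    (S : DLDPSData EE EM φ) (g : G) (ε : E) (u : EE) :
    S.dphi (g • ε) (dsmul EE g ε u) = dsmul EM g (φ ε) (S.dphi ε u) := by
  have hφ := hA.contMDiff_phi.mdifferentiable (by simp)
  have h1 := (hφ (g • ε)).hasMFDerivAt.comp ε (hA.mdifferentiable_smul_total g ε).hasMFDerivAt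
  have h2 := (hA.mdifferentiable_smul_base g (φ ε)).hasMFDerivAt.comp ε (hφ ε).hasMFDerivAt
  have h3 : φ ∘ (fun ε : E => g • ε) = (fun m : M => g • m) ∘ φ := by
    ext ε
    exact hA.equivariant g ε
  rw [h3] at h1
  exact congrArg (fun T : EE →L[ℝ] EM => T u) (hasMFDerivAt_unique h1 h2)

variable [hA : ActsOnFiberBundle EE EM EF EG EB F G φ]
  [IsManifold 𝓘(ℝ, EF) ∞ F] [IsManifold 𝓘(ℝ, EB) ∞ (MulAction.orbitRel.Quotient G M)]
  (A : DiscreteConnection EM EG EB M G)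

namespace DiscreteConnection

variable (EE EF F φ) in
/-- The differential of `Υ`, in the coordinates of the tangent spaces. -/
def dupsilon (x : E × M) : EE × EM →L[ℝ] (EB × EF × EG) × EB :=
  mfderiv (𝓘(ℝ, EE).prod 𝓘(ℝ, EM)) (𝓘(ℝ, EB × EF × EG).prod 𝓘(ℝ, EB)) (A.upsilon EE F φ) x

variable (EE EF F φ) in
/-- The differential of `p₁ ∘ Υ`, in the coordinates of the tangent spaces. -/
def dupsilonFst (x : E × M) : EE × EM →L[ℝ] EB × EF × EG :=
  mfderiv (𝓘(ℝ, EE).prod 𝓘(ℝ, EM)) 𝓘(ℝ, EB × EF × EG) (fun x' => (A.upsilon EE F φ x').1) x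

theorem hasMFDerivAt_upsilon {x : E × M} (hx : x ∈ A.upsilonDomain φ) :
    HasMFDerivAt (𝓘(ℝ, EE).prod 𝓘(ℝ, EM)) (𝓘(ℝ, EB × EF × EG).prod 𝓘(ℝ, EB)) (A.upsilon EE F φ) x
      (A.dupsilon EE EF F φ x) :=
  ((A.contMDiffAt_upsilon hx).mdifferentiableAt (by simp)).hasMFDerivAt

theorem hasMFDerivAt_upsilon_fst {x : E × M} (hx : x ∈ A.upsilonDomain φ) :
    HasMFDerivAt (𝓘(ℝ, EE).prod 𝓘(ℝ, EM)) 𝓘(ℝ, EB × EF × EG) (fun z => (A.upsilon EE F φ z).1) x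
      (A.dupsilonFst EE EF F φ x) :=
  ((A.contMDiffAt_upsilon hx).mdifferentiableAt (by simp)).fst.hasMFDerivAt

theorem dupsilon_apply {x : E × M} (hx : x ∈ A.upsilonDomain φ) (v : EE × EM) :
    A.dupsilon EE EF F φ x v = (A.dupsilonFst EE EF F φ x v, dorbitProj EM EB G x.2 v.2) := by
  have h1 := (hasMFDerivAt_fst (A.upsilon EE F φ x)).comp x
    (A.hasMFDerivAt_upsilon (EE := EE) (EF := EF) (F := F) hx)
  have h2 := (hasMFDerivAt_snd (A.upsilon EE F φ x)).comp x
    (A.hasMFDerivAt_upsilon (EE := EE) (EF := EF) (F := F) hx)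
  have h3 := A.hasMFDerivAt_upsilon_fst (EE := EE) (EF := EF) (F := F) hx
  have h4 := ((hA.contMDiff_orbitProj.mdifferentiable (by simp)) x.2).hasMFDerivAt.comp x
    (hasMFDerivAt_snd (I := 𝓘(ℝ, EE)) (I' := 𝓘(ℝ, EM)) x)
  exact Prod.ext
    (congrArg (fun T : EE × EM →L[ℝ] EB × EF × EG => T v) (hasMFDerivAt_unique h1 h3))
    (congrArg (fun T : EE × EM →L[ℝ] EB => T v) (hasMFDerivAt_unique h2 h4))

/-- Differentiates Υ(g · z) = Υ(z), an identity on the open domain of Υ. -/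
theorem dupsilon_smul (g : G) {x : E × M} (hx : x ∈ A.upsilonDomain φ) (v : EE × EM) :
    A.dupsilon EE EF F φ (g • x) (dsmul EE g x.1 v.1, dsmul EM g x.2 v.2) =
      A.dupsilon EE EF F φ x v := by
  have h1 : HasMFDerivAt (𝓘(ℝ, EE).prod 𝓘(ℝ, EM)) (𝓘(ℝ, EE).prod 𝓘(ℝ, EM))
      (fun x : E × M => g • x) x ((dsmul EE g x.1).prodMap (dsmul EM g x.2)) :=
    HasMFDerivAt.prodMap (hA.mdifferentiable_smul_total g x.1).hasMFDerivAt
      (hA.mdifferentiable_smul_base g x.2).hasMFDerivAt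
  have h2 := (A.hasMFDerivAt_upsilon (EE := EE) (EF := EF) (F := F)
    (A.smul_mem_upsilonDomain hA g hx)).comp x h1
  have h3 := h2.congr_of_eventuallyEq (f₁ := A.upsilon EE F φ) (by
    filter_upwards [(A.contMDiffAt_form_phi hA hx).1] with z hz
    exact (A.upsilon_smul hA g hz).symm)
  exact congrArg (fun T : EE × EM →L[ℝ] (EB × EF × EG) × EB => T v)
    (hasMFDerivAt_unique h3 (A.hasMFDerivAt_upsilon hx))

theorem dupsilonFst_smul (g : G) {x : E × M} (hx : x ∈ A.upsilonDomain φ) (v : EE × EM) :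
    A.dupsilonFst EE EF F φ (g • x) (dsmul EE g x.1 v.1, dsmul EM g x.2 v.2) =
      A.dupsilonFst EE EF F φ x v := by
  have h := congrArg Prod.fst (A.dupsilon_smul (EF := EF) (F := F) g hx v)
  rwa [A.dupsilon_apply (A.smul_mem_upsilonDomain hA g hx), A.dupsilon_apply hx] at h

/-- The second component of Υ does not involve ε, so dΥ preserves the shape (δε, 0) of constraint
vectors. -/
theorem dupsilon_mk_zero {x : E × M} (hx : x ∈ A.upsilonDomain φ) (u : EE) :
    A.dupsilon EE EF F φ x (u, 0) = (A.dupsilonFst EE EF F φ x (u, 0), 0) := by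
  rw [A.dupsilon_apply hx, map_zero]

/-- The action on M is free, so no nonzero (δε, 0) is tangent to an orbit. Formally, the chain rule
is applied to the local left inverse from `exists_leftInverse_upsilon`. -/
theorem dupsilonFst_injective {x : E × M} (hx : x ∈ A.upsilonDomain φ) {u v : EE}
    (h : A.dupsilonFst EE EF F φ x (u, 0) = A.dupsilonFst EE EF F φ x (v, 0)) : u = v := by
  obtain ⟨H, hH, he⟩ := A.exists_leftInverse_upsilon (EE := EE) (EF := EF) (F := F) hx
  have h1 : HasMFDerivAt 𝓘(ℝ, EE) (𝓘(ℝ, EE).prod 𝓘(ℝ, EM)) (fun ε : E => (ε, x.2)) x.1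
      (ContinuousLinearMap.inl ℝ EE EM) :=
    (hasMFDerivAt_id x.1).prodMk (hasMFDerivAt_const x.2 x.1)
  have h2 := ((hH.mdifferentiableAt (by simp)).hasMFDerivAt.comp x
    (A.hasMFDerivAt_upsilon (EE := EE) (EF := EF) (F := F) hx)).comp x.1 h1
  have h3 := (hasMFDerivAt_id (I := 𝓘(ℝ, EE)) x.1).congr_of_eventuallyEq (f₁ := _) he
  have h4 := hasMFDerivAt_unique h2 h3
  have h5 : A.dupsilon EE EF F φ x (u, 0) = A.dupsilon EE EF F φ x (v, 0) := by
    rw [A.dupsilon_mk_zero hx, A.dupsilon_mk_zero hx, h]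
  have h6 : ∀ w : EE, (mfderiv (𝓘(ℝ, EB × EF × EG).prod 𝓘(ℝ, EB)) 𝓘(ℝ, EE) H
      (A.upsilon EE F φ x) : (EB × EF × EG) × EB →L[ℝ] EE) (A.dupsilon EE EF F φ x (w, 0)) = w :=
    fun w => congrArg (fun T : EE →L[ℝ] EE => T w) h4
  rw [← h6 u, ← h6 v, h5]

variable (S : DLDPSData EE EM φ)

/-- Differentiates p^{M/G} ∘ p₁ ∘ Υ = π ∘ φ ∘ p₁. In particular vertical δε gives a vertical image,
whatever δm is. -/
theorem dphi_reduce_dupsilonFst {x : E × M} (hx : x ∈ A.upsilonDomain φ) (v : EE × EM) :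
    (A.reduce EF F S).dphi (A.upsilon EE F φ x).1 (A.dupsilonFst EE EF F φ x v) =
      dorbitProj EM EB G (φ x.1) (S.dphi x.1 v.1) := by
  have h1 := (((ConjBundle.contMDiff_proj EE EM EF EG EB F G φ).mdifferentiable (by simp))
    (A.upsilon EE F φ x).1).hasMFDerivAt.comp x (A.hasMFDerivAt_upsilon_fst hx)
  have h2 := (((hA.contMDiff_orbitProj.mdifferentiable (by simp)) (φ x.1)).hasMFDerivAt.comp x.1
    ((hA.contMDiff_phi.mdifferentiable (by simp)) x.1).hasMFDerivAt).comp x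
    (hasMFDerivAt_fst (I := 𝓘(ℝ, EE)) (I' := 𝓘(ℝ, EM)) x)
  exact congrArg (fun T : EE × EM →L[ℝ] EB => T v) (hasMFDerivAt_unique h1 h2)

variable {S}

/-- The preimage chosen in `reduce` is a translate of x, and the Lagrangian is invariant. -/
theorem reduce_L_upsilon (hG : S.IsInvariant G) {x : E × M} (hx : x ∈ A.upsilonDomain φ) :
    (A.reduce EF F S).L (A.upsilon EE F φ x) = S.L x := by
  have h : ∃ x' ∈ A.upsilonDomain φ, A.upsilon EE F φ x' = A.upsilon EE F φ x := ⟨x, hx, rfl⟩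
  refine (dif_pos h).trans ?_
  obtain ⟨g, hg⟩ := A.exists_smul_of_upsilon_eq hA hx h.choose_spec.1 h.choose_spec.2.symm
  rw [hg, hG.invariant_L]

/-- Near Υ(x) the reduced Lagrangian is the original one composed with a smooth local section of Υ.
-/
theorem mdifferentiableAt_reduce_L (hG : S.IsInvariant G) {x : E × M}
    (hx : x ∈ A.upsilonDomain φ)
    (hL : MDifferentiable (𝓘(ℝ, EE).prod 𝓘(ℝ, EM)) 𝓘(ℝ, ℝ) S.L) :
    MDifferentiableAt (𝓘(ℝ, EB × EF × EG).prod 𝓘(ℝ, EB)) 𝓘(ℝ, ℝ) (A.reduce EF F S).L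
      (A.upsilon EE F φ x) := by
  obtain ⟨σ, hσ, he⟩ := A.exists_section_upsilon (EE := EE) (EF := EF) (F := F) hx
  refine ((hL _).comp _ (hσ.mdifferentiableAt (by simp))).congr_of_eventuallyEq ?_
  filter_upwards [he] with w hw
  have h := A.reduce_L_upsilon (EF := EF) (F := F) hG hw.1
  rw [hw.2] at h
  exact h

theorem dL_reduce_dupsilon (hG : S.IsInvariant G) {x : E × M} (hx : x ∈ A.upsilonDomain φ)
    (hL : MDifferentiable (𝓘(ℝ, EE).prod 𝓘(ℝ, EM)) 𝓘(ℝ, ℝ) S.L) (v : EE × EM) :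
    (A.reduce EF F S).dL (A.upsilon EE F φ x) (A.dupsilon EE EF F φ x v) = S.dL x v := by
  have h1 := (A.mdifferentiableAt_reduce_L (EF := EF) (F := F) hG hx hL).hasMFDerivAt.comp x
    (A.hasMFDerivAt_upsilon hx)
  have h2 := (hL x).hasMFDerivAt.congr_of_eventuallyEq
      (f₁ := (A.reduce EF F S).L ∘ A.upsilon EE F φ) (by
    filter_upwards [(A.contMDiffAt_form_phi hA hx).1] with z hz
    exact A.reduce_L_upsilon hG hz)
  exact congrArg (fun T : EE × EM →L[ℝ] ℝ => T v) (hasMFDerivAt_unique h1 h2)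

theorem upsilon_mem_reduce_Dd (hG : S.IsInvariant G) {x : E × M} (hx : x ∈ A.upsilonDomain φ) :
    A.upsilon EE F φ x ∈ (A.reduce EF F S).Dd ↔ x ∈ S.Dd := by
  refine ⟨?_, fun h => ⟨x, ⟨h, hx⟩, rfl⟩⟩
  rintro ⟨x', ⟨hd, hx'⟩, h⟩
  obtain ⟨g, rfl⟩ := A.exists_smul_of_upsilon_eq hA hx' hx h
  exact hG.invariant_Dd g _ hd

/-- The fiber of the reduced variational constraints at `Υ(y)` is the image of the fiber at `y`. -/
theorem exists_of_mem_reduce_D (hG : S.IsInvariant G) {y : E × M} (hy : y ∈ A.upsilonDomain φ)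
    {w : EB × EF × EG} (hw : w ∈ (A.reduce EF F S).fiber (A.upsilon EE F φ y)) :
    ∃ u ∈ S.fiber y, A.dupsilonFst EE EF F φ y (u, 0) = w := by
  have key : ∀ y' ∈ A.upsilonDomain φ, A.upsilon EE F φ y' = A.upsilon EE F φ y →
      ∀ u ∈ S.fiber y', ∀ w : EB × EF × EG, A.dupsilon EE EF F φ y' (u, 0) = (w, 0) →
      ∃ u ∈ S.fiber y, A.dupsilonFst EE EF F φ y (u, 0) = w := by
    intro y' hy' he u hu w h
    obtain ⟨g, rfl⟩ := A.exists_smul_of_upsilon_eq hA hy' hy he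
    refine ⟨dsmul EE g y'.1 u, hG.invariant_D g y' u hu, ?_⟩
    have h1 := A.dupsilonFst_smul (EF := EF) (F := F) g hy' (u, 0)
    rw [map_zero] at h1
    rw [A.dupsilon_mk_zero hy'] at h
    exact h1.trans (congrArg Prod.fst h)
  let T : EE →ₗ[ℝ] EB × EF × EG :=
    ((A.dupsilonFst EE EF F φ y).comp (ContinuousLinearMap.inl ℝ EE EM)).toLinearMap
  -- The span in `reduce` adds nothing: preimages other than y are translates of it and contribute
  -- the same vectors, and the linear image of the fiber at y is already a subspace.
  suffices h : (A.reduce EF F S).fiber (A.upsilon EE F φ y) ≤ (S.fiber y).map T from h hw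
  refine Submodule.span_le.2 ?_
  rintro w ⟨y', hy', he, u, hu, h⟩
  exact key y' hy' he u hu w h

theorem dupsilonFst_mem_reduce_D {y : E × M} (hy : y ∈ A.upsilonDomain φ) {u : EE}
    (hu : u ∈ S.fiber y) :
    A.dupsilonFst EE EF F φ y (u, 0) ∈ (A.reduce EF F S).fiber (A.upsilon EE F φ y) := by
  have h : (A.dupsilonFst EE EF F φ y (u, 0) :
      TangentSpace 𝓘(ℝ, EB × EF × EG) (A.upsilon EE F φ y).1) ∈
      (A.reduce EF F S).D (A.upsilon EE F φ y) :=
    Submodule.subset_span ⟨y, hy, rfl, u, hu, A.dupsilon_mk_zero hy u⟩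
  exact h

/-- The defining formula of the reduced chaining map, which shows that it is well defined. -/
theorem chain_reduce_dupsilonFst (hG : S.IsInvariant G) {x y : E × M}
    (hx : x ∈ A.upsilonDomain φ) (hy : y ∈ A.upsilonDomain φ) (hxy : Chained φ x y)
    {u : EE} (hu : u ∈ S.fiber y) :
    (A.reduce EF F S).chain (A.upsilon EE F φ x) (A.upsilon EE F φ y)
      (A.dupsilonFst EE EF F φ y (u, 0)) =
      A.dupsilonFst EE EF F φ x (S.chain x y u, S.dphi y.1 u) := by
  have h : ∃ (x' y' : E × M) (δε : EE),
      x' ∈ A.upsilonDomain φ ∧ y' ∈ A.upsilonDomain φ ∧ Chained φ x' y' ∧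
      A.upsilon EE F φ x' = A.upsilon EE F φ x ∧ A.upsilon EE F φ y' = A.upsilon EE F φ y ∧
      δε ∈ S.fiber y' ∧ A.dupsilon EE EF F φ y' (δε, 0) =
        (A.dupsilonFst EE EF F φ y (u, 0), 0) :=
    ⟨x, y, u, hx, hy, hxy, rfl, rfl, hu, A.dupsilon_mk_zero hy u⟩
  have hval : (A.reduce EF F S).chain (A.upsilon EE F φ x) (A.upsilon EE F φ y)
      (A.dupsilonFst EE EF F φ y (u, 0)) =
      A.dupsilonFst EE EF F φ h.choose (S.chain h.choose h.choose_spec.choose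
        h.choose_spec.choose_spec.choose, S.dphi h.choose_spec.choose.1
          h.choose_spec.choose_spec.choose) := dif_pos h
  rw [hval]
  have hspec := h.choose_spec.choose_spec.choose_spec
  -- From here on only the defining properties of the chosen preimages are used, so the value is
  -- shown to be independent of the choice.
  generalize h.choose_spec.choose_spec.choose = u' at hspec ⊢
  generalize h.choose_spec.choose = y' at hspec ⊢
  generalize h.choose = x' at hspec ⊢
  obtain ⟨hx', hy', hxy', hex, hey, hu', he⟩ := hspec
  obtain ⟨g, rfl⟩ := A.exists_smul_of_upsilon_eq hA hx hx' hex.symm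
  obtain ⟨k, rfl⟩ := A.exists_smul_of_upsilon_eq hA hy hy' hey.symm
  -- The chosen pair is (gx, ky). Chaining means that g and k send the same point of M to the same
  -- point, so freeness gives g = k.
  have hgk : g = k := by
    have h1 : g • x.2 = φ (k • y.1) := hxy'
    rw [hA.equivariant, ← hxy] at h1
    exact smul_left_injective_of_free hA.free_base h1
  subst hgk
  rw [A.dupsilon_mk_zero hy'] at he
  have h1 := A.dupsilonFst_smul (EF := EF) (F := F) g hy (u, 0)
  rw [map_zero] at h1
  have h2 : u' = dsmul EE g y.1 u :=
    A.dupsilonFst_injective hy' ((congrArg Prod.fst he).trans h1.symm)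
  subst h2
  have h3 : S.chain (g • x) (g • y) (dsmul EE g y.1 u) = dsmul EE g x.1 (S.chain x y u) :=
    hG.equivariant_P g x y hxy u hu
  have h4 := hA.dphi_dsmul S g y.1 u
  rw [← hxy] at h4
  have h5 := A.dupsilonFst_smul (EF := EF) (F := F) g hx (S.chain x y u, S.dphi y.1 u)
  rw [← h3, ← h4] at h5
  exact h5

/-- In the form `nu_eq`, both arguments of the differential of L_d are carried by dΥ to their
reduced counterparts: (u, 0) at y, and (𝒫u, dφ u) at x. -/
theorem nu_reduce_dupsilonFst (hG : S.IsInvariant G)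
    (hL : MDifferentiable (𝓘(ℝ, EE).prod 𝓘(ℝ, EM)) 𝓘(ℝ, ℝ) S.L) {x y : E × M}
    (hx : x ∈ A.upsilonDomain φ) (hy : y ∈ A.upsilonDomain φ) (hxy : Chained φ x y)
    {u : EE} (hu : u ∈ S.fiber y) :
    (A.reduce EF F S).nu (A.upsilon EE F φ x) (A.upsilon EE F φ y)
      (A.dupsilonFst EE EF F φ y (u, 0)) = S.nu x y u := by
  refine (DLDPSData.nu_eq _ _ _ _).trans ?_
  rw [S.nu_eq]
  have h1 := A.dL_reduce_dupsilon (EF := EF) (F := F) hG hy hL (u, 0)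
  have h2 := A.dL_reduce_dupsilon (EF := EF) (F := F) hG hx hL (S.chain x y u, S.dphi y.1 u)
  rw [A.dupsilon_mk_zero hy] at h1
  rw [A.dupsilon_apply hx, ← A.chain_reduce_dupsilonFst hG hx hy hxy hu] at h2
  have h3 := A.dphi_reduce_dupsilonFst (EF := EF) (F := F) S hy (u, 0)
  -- Chaining makes dπ at m_1, from the second component of Υ(x), the same map as dπ at φ(ε_1), from
  -- the reduced projection.
  rw [← hxy] at h3
  rw [← h3] at h2
  rw [← h1, ← h2]

end DiscreteConnection

end Differentials

/-! ### Transfer of the equations of motion to the reduced system -/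

section Reduction

variable {EE EM EF EG EB : Type*}
  [NormedAddCommGroup EE] [NormedSpace ℝ EE] [NormedAddCommGroup EM] [NormedSpace ℝ EM]
  [NormedAddCommGroup EF] [NormedSpace ℝ EF] [NormedAddCommGroup EG] [NormedSpace ℝ EG]
  [NormedAddCommGroup EB] [NormedSpace ℝ EB]
  {E M F G : Type*} [TopologicalSpace E] [ChartedSpace EE E] [IsManifold 𝓘(ℝ, EE) ∞ E]
  [TopologicalSpace M] [ChartedSpace EM M] [TopologicalSpace F] [ChartedSpace EF F]
  [TopologicalSpace G] [ChartedSpace EG G] [Group G]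
  [MulAction G E] [MulAction G M] [MulAction Gᵐᵒᵖ F]
  [ChartedSpace EB (MulAction.orbitRel.Quotient G M)]
  {φ : E → M} [LieGroup 𝓘(ℝ, EG) ∞ G]
  {S : DLDPSData EE EM φ}

theorem DLDPSData.IsDLDPS.chain_zero (hS : S.IsDLDPS EF F) {x y : E × M} (hxy : Chained φ x y) :
    S.chain x y 0 = 0 := by
  have h1 : S.chain x y ((0 : ℝ) • (0 : EE)) = (0 : ℝ) • S.chain x y 0 :=
    hS.smul_P x y hxy 0 0 (S.D y).zero_mem
  rwa [zero_smul, zero_smul] at h1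

variable [hA : ActsOnFiberBundle EE EM EF EG EB F G φ]
  [IsManifold 𝓘(ℝ, EF) ∞ F] [IsManifold 𝓘(ℝ, EB) ∞ (MulAction.orbitRel.Quotient G M)]
  (A : DiscreteConnection EM EG EB M G)

theorem isDiscretePath_upsilon {N : ℕ} {x : Fin N → E × M} (hx : IsDiscretePath φ x) :
    IsDiscretePath (ConjBundle.proj EE EM EF EG EB F G φ) fun k => A.upsilon EE F φ (x k) :=
  fun k hk => congrArg (orbitProj G M) (hx k hk)

/-- The hypotheses of `isTrajectory_iff` are needed only along the path, where every point is some
Υ(x_k) and the formula for the reduced chaining map applies. -/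
theorem isTrajectory_reduce_iff (hS : S.IsDLDPS EF F) (hG : S.IsInvariant G) {N : ℕ}
    {x : Fin N → E × M} (hx : IsDiscretePath φ x) (hdom : ∀ k, x k ∈ A.upsilonDomain φ) :
    (A.reduce EF F S).IsTrajectory (fun k => A.upsilon EE F φ (x k)) ↔
      (A.reduce EF F S).SatisfiesEquations fun k => A.upsilon EE F φ (x k) := by
  have hL := hS.smooth_L.mdifferentiable (by simp)
  refine DLDPSData.isTrajectory_iff _ (isDiscretePath_upsilon A hx)
    (fun k => A.mdifferentiableAt_reduce_L hG (hdom k) hL) ?_ ?_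
  · intro k hk
    have h := A.chain_reduce_dupsilonFst (EF := EF) (F := F) hG (hdom ⟨k, Nat.lt_of_succ_lt hk⟩)
      (hdom ⟨k + 1, hk⟩) (hx k hk) (S.fiber (x ⟨k + 1, hk⟩)).zero_mem
    rw [hS.chain_zero (hx k hk), map_zero, ← Prod.zero_eq_mk, map_zero,
      map_zero] at h
    exact h
  -- Verticality: the reduced projection sends the chained vector to dπ(dφ(𝒫u)), and dφ(𝒫u) = 0.
  · intro k hk w hw
    obtain ⟨u, hu, h⟩ := A.exists_of_mem_reduce_D hG (hdom ⟨k + 1, hk⟩) hw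
    have h1 := A.chain_reduce_dupsilonFst (EF := EF) (F := F) hG
      (hdom ⟨k, Nat.lt_of_succ_lt hk⟩) (hdom ⟨k + 1, hk⟩) (hx k hk) hu
    have h2 := A.dphi_reduce_dupsilonFst (EF := EF) (F := F) S (hdom ⟨k, Nat.lt_of_succ_lt hk⟩)
      (S.chain (x ⟨k, Nat.lt_of_succ_lt hk⟩) (x ⟨k + 1, hk⟩) u, S.dphi (x ⟨k + 1, hk⟩).1 u)
    have h3 : S.dphi (x ⟨k, Nat.lt_of_succ_lt hk⟩).1
        (S.chain (x ⟨k, Nat.lt_of_succ_lt hk⟩) (x ⟨k + 1, hk⟩) u) = 0 :=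
      hS.vertical_P _ _ (hx k hk) u hu
    rw [← h1, h, h3, map_zero] at h2
    exact h2

/-- dΥ maps the constraint fiber at x_k onto the reduced one at Υ(x_k), and the sections of motion
agree under this map. -/
theorem satisfiesEquations_reduce_iff (hS : S.IsDLDPS EF F) (hG : S.IsInvariant G) {N : ℕ}
    {x : Fin N → E × M} (hx : IsDiscretePath φ x) (hdom : ∀ k, x k ∈ A.upsilonDomain φ) :
    ((A.reduce EF F S).SatisfiesEquations fun k => A.upsilon EE F φ (x k)) ↔
      S.SatisfiesEquations x := by
  have hL := hS.smooth_L.mdifferentiable (by simp)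
  refine and_congr (forall_congr' fun k => A.upsilon_mem_reduce_Dd hG (hdom k))
    (forall_congr' fun k => forall_congr' fun hk => ⟨fun h u hu => ?_, fun h w hw => ?_⟩)
  · rw [← A.nu_reduce_dupsilonFst (EF := EF) (F := F) hG hL (hdom ⟨k, Nat.lt_of_succ_lt hk⟩)
      (hdom ⟨k + 1, hk⟩) (hx k hk) hu]
    exact h _ (A.dupsilonFst_mem_reduce_D (hdom ⟨k + 1, hk⟩) hu)
  · obtain ⟨u, hu, rfl⟩ := A.exists_of_mem_reduce_D hG (hdom ⟨k + 1, hk⟩) hw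
    exact (A.nu_reduce_dupsilonFst (EF := EF) (F := F) hG hL (hdom ⟨k, Nat.lt_of_succ_lt hk⟩)
      (hdom ⟨k + 1, hk⟩) (hx k hk) hu).trans (h u hu)

end Reduction

end

end DLDP

theorem mainTheorem3
    {EE EM EF EG EB : Type*}
    [NormedAddCommGroup EE] [NormedSpace ℝ EE] [FiniteDimensional ℝ EE]
    [NormedAddCommGroup EM] [NormedSpace ℝ EM] [FiniteDimensional ℝ EM]
    [NormedAddCommGroup EF] [NormedSpace ℝ EF] [FiniteDimensional ℝ EF]
    [NormedAddCommGroup EG] [NormedSpace ℝ EG] [FiniteDimensional ℝ EG]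
    [NormedAddCommGroup EB] [NormedSpace ℝ EB] [FiniteDimensional ℝ EB]
    {E M F G : Type*}
    [TopologicalSpace E] [ChartedSpace EE E] [IsManifold 𝓘(ℝ, EE) ∞ E]
    [TopologicalSpace M] [ChartedSpace EM M] [IsManifold 𝓘(ℝ, EM) ∞ M]
    [TopologicalSpace F] [ChartedSpace EF F] [IsManifold 𝓘(ℝ, EF) ∞ F]
    [TopologicalSpace G] [ChartedSpace EG G] [Group G] [LieGroup 𝓘(ℝ, EG) ∞ G]
    [MulAction G E] [MulAction G M] [MulAction Gᵐᵒᵖ F]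
    [ChartedSpace EB (MulAction.orbitRel.Quotient G M)]
    [IsManifold 𝓘(ℝ, EB) ∞ (MulAction.orbitRel.Quotient G M)]
    {φ : E → M}
    (S : DLDP.DLDPSData EE EM φ) (hS : S.IsDLDPS EF F)
    [DLDP.ActsOnFiberBundle EE EM EF EG EB F G φ] (hG : S.IsInvariant G)
    (A : DLDP.DiscreteConnection EM EG EB M G)
    {N : ℕ} (x : Fin N → E × M) (hx : DLDP.IsDiscretePath φ x)
    (hdom : ∀ k, x k ∈ A.upsilonDomain φ)
    (y : Fin N → DLDP.ConjBundle G EE EM F φ × MulAction.orbitRel.Quotient G M)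
    (hy : ∀ k, A.upsilon EE F φ (x k) = y k) :
    DLDP.IsDiscretePath (DLDP.ConjBundle.proj EE EM EF EG EB F G φ) y ∧
    List.TFAE [
      S.IsTrajectory x,
      S.SatisfiesEquations x,
      (A.reduce EF F S).IsTrajectory y,
      (A.reduce EF F S).SatisfiesEquations y] := by
  obtain rfl : (fun k => A.upsilon EE F φ (x k)) = y := funext hy
  refine ⟨DLDP.isDiscretePath_upsilon A hx, ?_⟩
  have h12 : S.IsTrajectory x ↔ S.SatisfiesEquations x :=
    S.isTrajectory_iff hx (fun k => hS.smooth_L.mdifferentiable (by simp) (x k))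
      (fun k hk => hS.chain_zero (hx k hk)) (fun k hk u hu => hS.vertical_P _ _ (hx k hk) u hu)
  have h34 := DLDP.isTrajectory_reduce_iff A hS hG hx hdom
  have h42 := DLDP.satisfiesEquations_reduce_iff A hS hG hx hdom
  tfae_have 1 ↔ 2 := h12
  tfae_have 3 ↔ 4 := h34
  tfae_have 4 ↔ 2 := h42
  tfae_finish
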